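/- Let $p\ge 5$ be a prime, $\mathbb F$ a finite field of characteristic $p$ and $r\ge 1$. Let $K_1=\{g\in \mathrm{GL}_2(\mathbb Z_p): g\equiv 1 \bmod p\}$, let $Z_1$ be the subgroup of scalar matrices in $K_1$, and for $n\ge 1$ let \[T_1(p^n)=\begin{pmatrix}1+p\mathbb Z_p & p^n\mathbb Z_p\\ p^n\mathbb Z_p & 1+p\mathbb Z_p\end{pmatrix}\subset K_1 .\] Put $\mathscr K_1=\prod_{i=1}^r K_1$, $\mathscr Z_1=\prod_{i=1}^r Z_1$, $\Lambda=\mathbb F[[\mathscr K_1/\mathscr Z_1]]=\varprojlim_N \mathbb F[(\mathscr K_1/\mathscr Z_1)/N]$ ($N$ running over the open normal subgroups) and, for $\mathbf n=(n_1,\dots,n_r)\in(\mathbb Z_{\ge 1})^r$, $\mathscr T_1(p^{\mathbf n})=\prod_{i=1}^r T_1(p^{n_i})$ and $\kappa(\mathbf n)=\max_i n_i$. For a $\Lambda$-module $N$, let $N_{\mathscr T_1(p^{\mathbf n})}$ be the space of coinvariants, i.e. the quotient of $N$ by the $\mathbb F$-span of all $t\cdot x-x$ with $t\in\mathscr T_1(p^{\mathbf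 n})$ and $x\in N$. For functions $f,g\ge 0$ of $\mathbf n$, write $f\ll g$ if there is a constant $C$ with $f(\mathbf n)\le C g(\mathbf n)$ for all $\mathbf n\in(\mathbb Z_{\ge1})^r$, and $f\sim g$ if $f\ll g$ and $g\ll f$. Let $M$ be a finitely generated $\Lambda$-module and $\phi\in\mathrm{End}_\Lambda(M)$ with $\bigcap_{k\ge 1}\phi^k(M)=0$. Then all the spaces $M_{\mathscr T_1(p^{\mathbf n})}$ are finite dimensional over $\mathbb F$, and the following hold (the implied constants do not depend on $\mathbf n$). (i) If $\phi$ is nilpotent, then $\dim_{\mathbb F}M_{\mathscr T_1(p^{\mathbf n})}\sim \dim_{\mathbb F}\big(M/\phi(M)\big)_{\mathscr T_1(p^{\mathbf n})}$. (ii) If $\phi$ is not nilpotent, then for every sufficiently large $k_0$ \[\dim_{\mathbb F}M_{\mathscr T_1(p^{\mathbf n})}\ll \max\Big\{\dim_{\mathbb F}\big(M/\phi(M)\big)_{\mathscr T_1(p^{\mathbf n})},\ p^{\kappa(\mathbf n)}\dim_{\mathbb F}\big(\phi^{k_0}(M)/\phi^{k_0+1}(M)\big)_{\mathscr T_1(p^{\mathbf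 n})}\Big\}.\] In any case, $\dim_{\mathbb F}M_{\mathscr T_1(p^{\mathbf n})}\ll p^{\kappa(\mathbf n)}\dim_{\mathbb F}\big(M/\phi(M)\big)_{\mathscr T_1(p^{\mathbf n})}$. -/

import Mathlib

open scoped MatrixGroups

noncomputable section

/-! ### Completed group algebras -/

/-- The completed group algebra `F[[G]] = lim F[G/N]`, the limit being taken over the open normal
subgroups `N` of `G`: the compatible families in the product of the group algebras `F[G/N]`. -/
def completedGroupAlgebra (F : Type*) [Field F] (G : Type*) [Group G] [TopologicalSpace G] :
    Subalgebra F (∀ N : OpenNormalSubgroup G, MonoidAlgebra F (G ⧸ N.toSubgroup)) where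
  carrier := {x | ∀ (N N' : OpenNormalSubgroup G) (h : N.toSubgroup ≤ N'.toSubgroup),
    MonoidAlgebra.mapDomainAlgHom F F
      (QuotientGroup.map N.toSubgroup N'.toSubgroup (MonoidHom.id G) h) (x N) = x N'}
  mul_mem' {x y} hx hy N N' h := by
    simp only [Pi.mul_apply, map_mul, hx N N' h, hy N N' h]
  add_mem' {x y} hx hy N N' h := by
    simp only [Pi.add_apply, map_add, hx N N' h, hy N N' h]
  algebraMap_mem' a N N' h := by
    simp only [Pi.algebraMap_apply, AlgHom.commutes]

/-- The canonical homomorphism `G → F[[G]]`, `g ↦ [g]`. -/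
def completedGroupAlgebra.of (F : Type*) [Field F] (G : Type*) [Group G] [TopologicalSpace G] :
    G →* completedGroupAlgebra F G where
  toFun g := ⟨fun N => MonoidAlgebra.of F (G ⧸ N.toSubgroup) (QuotientGroup.mk g), by
    intro N N' h
    simp only [MonoidAlgebra.of_apply, MonoidAlgebra.mapDomainAlgHom_apply,
      MonoidAlgebra.mapDomain_single]
    rfl⟩
  map_one' := by
    ext1; funext N
    exact map_one (MonoidAlgebra.of F (G ⧸ N.toSubgroup))
  map_mul' g h := by
    ext1; funext N
    exact map_mul (MonoidAlgebra.of F (G ⧸ N.toSubgroup)) (QuotientGroup.mk g) (QuotientGroup.mk h)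

/-! ### The groups -/

/-- For `n ≥ 1`, the subgroup `T₁(pⁿ)` of `GL₂(ℤ_p)` of the matrices whose diagonal entries lie in
`1 + pℤ_p` and whose off-diagonal entries lie in `pⁿℤ_p`. -/
def T1 (p : ℕ) [Fact p.Prime] (n : ℕ+) : Subgroup (GL (Fin 2) ℤ_[p]) where
  carrier := {g | (p : ℤ_[p]) ∣ g 0 0 - 1 ∧ (p : ℤ_[p]) ^ (n : ℕ) ∣ g 0 1 ∧
    (p : ℤ_[p]) ^ (n : ℕ) ∣ g 1 0 ∧ (p : ℤ_[p]) ∣ g 1 1 - 1}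
  one_mem' := by simp
  mul_mem' {g h} := by
    rintro ⟨⟨a, ha⟩, ⟨b, hb⟩, ⟨c, hc⟩, ⟨d, hd⟩⟩ ⟨⟨a', ha'⟩, ⟨b', hb'⟩, ⟨c', hc'⟩, ⟨d', hd'⟩⟩
    obtain ⟨m, hm⟩ : ∃ m, (n : ℕ) = m + 1 := ⟨(n : ℕ) - 1, by have := n.pos; omega⟩
    rw [sub_eq_iff_eq_add] at ha hd ha' hd'
    simp only [Set.mem_ofPred_eq, Units.val_mul, Matrix.mul_apply, Fin.sum_univ_two]
    rw [ha, hb, hc, hd, ha', hb', hc', hd']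
    refine ⟨⟨a * a' * p + a + a' + p ^ m * b * (p ^ (n : ℕ) * c'), ?_⟩,
      ⟨(p * a + 1) * b' + b * (p * d' + 1), by ring⟩,
      ⟨c * (p * a' + 1) + (p * d + 1) * c', by ring⟩,
      ⟨d * d' * p + d + d' + p ^ m * c * (p ^ (n : ℕ) * b'), ?_⟩⟩ <;>
    · rw [hm]; ring
  inv_mem' {g} := by
    rintro ⟨ha, hb, hc, hd⟩
    have hp : (p : ℤ_[p]) ∣ (p : ℤ_[p]) ^ (n : ℕ) := dvd_pow_self _ n.ne_zero
    have key : (g : Matrix (Fin 2) (Fin 2) ℤ_[p]) * ((g⁻¹ : GL (Fin 2) ℤ_[p]) :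
        Matrix (Fin 2) (Fin 2) ℤ_[p]) = 1 := by
      rw [← Units.val_mul, mul_inv_cancel, Units.val_one]
    have h00 := congrFun (congrFun key 0) 0
    have h11 := congrFun (congrFun key 1) 1
    simp only [Matrix.mul_apply, Fin.sum_univ_two, Matrix.one_apply_eq] at h00 h11
    have hinv : ((g⁻¹ : GL (Fin 2) ℤ_[p]) : Matrix (Fin 2) (Fin 2) ℤ_[p]) =
        Ring.inverse (g : Matrix (Fin 2) (Fin 2) ℤ_[p]).det •
          (g : Matrix (Fin 2) (Fin 2) ℤ_[p]).adjugate := by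
      rw [Matrix.coe_units_inv, Matrix.inv_def]
    refine ⟨?_, ?_, ?_, ?_⟩
    · have e : (g⁻¹ : GL (Fin 2) ℤ_[p]) 0 0 - 1 =
          -((g 0 0 - 1) * (g⁻¹ : GL (Fin 2) ℤ_[p]) 0 0 +
            g 0 1 * (g⁻¹ : GL (Fin 2) ℤ_[p]) 1 0) := by linear_combination h00
      rw [e]
      exact (dvd_add (ha.mul_right _) ((hp.trans hb).mul_right _)).neg_right
    · rw [hinv, Matrix.adjugate_fin_two]
      simpa using hb
    · rw [hinv, Matrix.adjugate_fin_two]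
      simpa using hc
    · have e : (g⁻¹ : GL (Fin 2) ℤ_[p]) 1 1 - 1 =
          -(g 1 0 * (g⁻¹ : GL (Fin 2) ℤ_[p]) 0 1 +
            (g 1 1 - 1) * (g⁻¹ : GL (Fin 2) ℤ_[p]) 1 1) := by linear_combination h11
      rw [e]
      exact (dvd_add ((hp.trans hc).mul_right _) (hd.mul_right _)).neg_right

/-- The principal congruence subgroup `K₁` of `GL₂(ℤ_p)`, consisting of the matrices congruent to
the identity modulo `p`. -/
def K1 (p : ℕ) [Fact p.Prime] : Subgroup (GL (Fin 2) ℤ_[p]) :=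
  (Matrix.GeneralLinearGroup.map (n := Fin 2)
    (Ideal.Quotient.mk (Ideal.span {(p : ℤ_[p])}))).ker

/-- The subgroup `Z₁` of scalar matrices in `K₁`. -/
def Z1 (p : ℕ) [Fact p.Prime] : Subgroup (K1 p) :=
  (Subgroup.center (GL (Fin 2) ℤ_[p])).subgroupOf (K1 p)

instance Z1.normal (p : ℕ) [Fact p.Prime] : (Z1 p).Normal := by
  unfold Z1; infer_instance

/-- The product `𝒦₁` of `r` copies of `K₁`. -/
abbrev ProdK1 (p : ℕ) [Fact p.Prime] (r : ℕ) : Type := Fin r → K1 p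

/-- The product `𝒵₁` of `r` copies of `Z₁`. -/
def ProdZ1 (p : ℕ) [Fact p.Prime] (r : ℕ) : Subgroup (ProdK1 p r) :=
  Subgroup.pi Set.univ fun _ => Z1 p

instance ProdZ1.normal (p : ℕ) [Fact p.Prime] (r : ℕ) : (ProdZ1 p r).Normal where
  conj_mem x hx g i hi := (Z1.normal p).conj_mem (x i) (hx i hi) (g i)

/-- The subgroup `𝒯₁(pⁿ) = ∏ᵢ T₁(p^{nᵢ})` of `𝒦₁`, for `n = (n₁, …, n_r)` with all `nᵢ ≥ 1`. -/
def ProdT1 (p : ℕ) [Fact p.Prime] {r : ℕ} (n : Fin r → ℕ+) : Subgroup (ProdK1 p r) :=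
  Subgroup.pi Set.univ fun i => (T1 p (n i)).subgroupOf (K1 p)

/-- `κ(n) = maxᵢ nᵢ`. -/
def kappa {r : ℕ} (n : Fin r → ℕ+) : ℕ := Finset.univ.sup fun i => (n i : ℕ)

/-- The Iwasawa algebra `Λ = F[[𝒦₁/𝒵₁]]`. -/
abbrev Lam (F : Type*) [Field F] (p : ℕ) [Fact p.Prime] (r : ℕ) :=
  completedGroupAlgebra F (ProdK1 p r ⧸ ProdZ1 p r)

/-! ### Coinvariants -/

section

variable (F : Type*) [Field F] (p : ℕ) [Fact p.Prime] {r : ℕ}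
  (M : Type*) [AddCommGroup M] [Module F M] [Module (Lam F p r) M]
  [IsScalarTower F (Lam F p r) M]

/-- The action of `𝒦₁` on a `Λ`-module, `g` acting by `[g mod 𝒵₁] ∈ Λ`. -/
def prodK1Rep : Representation F (ProdK1 p r) M :=
  ((Algebra.lsmul F F M : Lam F p r →ₐ[F] Module.End F M) : Lam F p r →* Module.End F M).comp
    ((completedGroupAlgebra.of F (ProdK1 p r ⧸ ProdZ1 p r)).comp
      (QuotientGroup.mk' (ProdZ1 p r)))

/-- The coinvariants `M_{𝒯₁(pⁿ)}` of a `Λ`-module `M`: the quotient of `M` by the `F`-span of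
the elements `t • m - m` with `t ∈ 𝒯₁(pⁿ)` and `m ∈ M`. -/
abbrev coinv (n : Fin r → ℕ+) : Type _ :=
  Representation.Coinvariants ((prodK1Rep F p (r := r) M).comp (ProdT1 p n).subtype)

/-- The dimension over `F` of the coinvariants `M_{𝒯₁(pⁿ)}`. -/
def dimCoinv (n : Fin r → ℕ+) : ℕ := Module.finrank F (coinv F p M n)

end

/-! ### Growth -/

/-- `f ≪ g`: there is a constant `C` such that `f n ≤ C g n` for every `n`. -/
def Dominated {ι : Type*} (f g : ι → ℕ) : Prop := ∃ C : ℕ, ∀ n, f n ≤ C * g n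

/-- `f ∼ g`: `f ≪ g` and `g ≪ f`. -/
def Comparable {ι : Type*} (f g : ι → ℕ) : Prop := Dominated f g ∧ Dominated g f

/-- The graded piece `φᵏ(M)/φᵏ⁺¹(M)`. -/
abbrev gradedPiece {R M : Type*} [Ring R] [AddCommGroup M] [Module R M] (φ : Module.End R M)
    (k : ℕ) : Type _ :=
  ↥(LinearMap.range (φ ^ k)) ⧸
    (LinearMap.range (φ ^ (k + 1))).submoduleOf (LinearMap.range (φ ^ k))

end

/-! ### Nilpotency of the augmentation ideal of a finite group algebra -/

section Words

variable {F R : Type*} [Field F] [Ring R] [Algebra F R]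

/-! Write `V` for the coinvariants of `M` under `𝒯₁(pⁿ)`. Taking coinvariants is right exact, so the
coinvariants of `M/φ(M)` are `V/φ(V)`. Since `dim ker φ = dim coker φ` on `V`, each application of
`φ` lowers the dimension of the image by at most `dim V/φ(V)`; hence `dim V ≤ k · dim V/φ(V)` as
soon as `φᵏ` kills `V`. If `φ` is nilpotent, one `k` serves all `n`, which gives (i).

In general the question is how large `k` must be. Let `J` be the augmentation ideal of `Λ`.
Compactness and `⋂ φᵏ(M) = 0` give `φᵏ(M) ⊆ J M` for some `k` (`exists_pow_apply_mem_aug_smul`),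
hence `φᵏᵃ(M) ⊆ Jᵃ M` by linearity. It remains to show that `Jᵃ M` dies in `V` for some `a =
O(p^κ)`. The group `𝒯₁(pⁿ)` contains the congruence subgroup of level `p^κ`, which is topologically
generated by `p^(κ-1)`-th powers of the `4r` standard generators (`prodCongr_le_of_generators`). So
the kernel of the projection of `Λ` to the finite group algebra of level `p^κ` lies in the right
ideal generated by the `t - 1` (`exists_eq_sum_of_proj_eq_zero`), and it suffices that the
augmentation ideal of that finite algebra vanishes in degree `O(p^κ)`.

This is `augIdeal_pow_eq_bot`. The elements `x = [e] - 1`, for the `4r` generators `e`, satisfy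
`x^(p^s) = 0` at level `p^(s+1)`. They commute modulo the cube of the ideal, since commutators are
products of `p`-th powers and their inverses, and `[g^p] - 1 = ([g] - 1)^p`. A word of length `4r
p^s` can therefore be reordered, modulo higher degree, to contain some `x^(p^s) = 0`. The powers of
the ideal thus stabilise from there on, and the ideal of a finite `p`-group algebra is nilpotent.

For (ii), the same bound is applied to `φ` restricted to `φᵏ(M)`, the first `k` steps being paid for
by `M/φ(M)`. -/

lemma list_prod_mem_pow {J : Submodule F R} {l : List R} (hl : ∀ x ∈ l, x ∈ J) :
    l.prod ∈ J ^ l.length := by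
  induction l with
  | nil => simpa using Submodule.one_le.mp (le_refl (1 : Submodule F R))
  | cons x l ih =>
    rw [List.prod_cons, List.length_cons, pow_succ']
    exact Submodule.mul_mem_mul (hl x (by simp)) (ih fun y hy => hl y (by simp [hy]))

/-- Products of elements of `X ⊆ J` commuting modulo `J ^ 3` depend on the order of the factors
only up to an element of higher filtration degree. -/
lemma List.Perm.prod_sub_prod_mem_pow {J : Submodule F R} {X : Set R} (hX : ∀ x ∈ X, x ∈ J)
    (hc : ∀ x ∈ X, ∀ y ∈ X, x * y - y * x ∈ J ^ 3) {l₁ l₂ : List R} (h : l₁.Perm l₂)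
    (hl : ∀ x ∈ l₁, x ∈ X) : l₁.prod - l₂.prod ∈ J ^ (l₁.length + 1) := by
  induction h with
  | nil => simp
  | cons x _ ih =>
    rw [List.prod_cons, List.prod_cons, ← mul_sub, List.length_cons, pow_succ']
    exact Submodule.mul_mem_mul (hX x (hl x (by simp))) (ih fun y hy => hl y (by simp [hy]))
  | swap x y l =>
    have e : (y :: x :: l).prod - (x :: y :: l).prod = (y * x - x * y) * l.prod := by
      simp only [List.prod_cons]; noncomm_ring
    have e' : (y :: x :: l).length + 1 = 3 + l.length := by simp; omega
    rw [e, e', pow_add]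
    exact Submodule.mul_mem_mul (hc y (hl y (by simp)) x (hl x (by simp)))
      (list_prod_mem_pow fun z hz => hX z (hl z (by simp [hz])))
  | trans h₁ h₂ ih₁ ih₂ =>
    have := Submodule.add_mem _ (ih₁ hl)
      (h₁.length_eq ▸ ih₂ fun x hx => hl x (h₁.mem_iff.mpr hx))
    simpa using this

lemma List.exists_le_count_of_length_eq {ι : Type*} [Fintype ι] [Nonempty ι] [DecidableEq ι]
    {q : ℕ} {l : List ι} (hl : l.length = Fintype.card ι * q) : ∃ i, q ≤ l.count i := by
  by_contra! h
  have h1 : ∑ i, l.count i = l.length := by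
    simpa using Multiset.sum_count_eq_card (s := Finset.univ) (m := (l : Multiset ι)) (by simp)
  have h2 : ∑ i, l.count i < ∑ _i : ι, q :=
    Finset.sum_lt_sum_of_nonempty Finset.univ_nonempty fun i _ => h i
  simp at h2
  omega

/-- Generators modulo `J ^ 2` generate each `J ^ a` modulo `J ^ (a + 1)`: the graded algebra of `J`
is generated in degree one. -/
lemma pow_le_span_pow_sup {J : Submodule F R} {X : Set R} (hX : Submodule.span F X ≤ J)
    (hJ : J ≤ Submodule.span F X ⊔ J ^ 2) (a : ℕ) :
    J ^ a ≤ Submodule.span F X ^ a ⊔ J ^ (a + 1) := by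
  induction a with
  | zero => simp
  | succ a ih =>
    have hXa : Submodule.span F X ^ a ≤ J ^ a := pow_le_pow_left' hX a
    calc J ^ (a + 1) = J * J ^ a := pow_succ' _ _
      _ ≤ J * (Submodule.span F X ^ a ⊔ J ^ (a + 1)) := mul_le_mul_right ih _
      _ = J * Submodule.span F X ^ a ⊔ J ^ (a + 1 + 1) := by
        rw [Submodule.mul_sup, ← pow_succ']
      _ ≤ (Submodule.span F X ⊔ J ^ 2) * Submodule.span F X ^ a ⊔ J ^ (a + 1 + 1) :=
        sup_le_sup_right (mul_le_mul_left hJ _) _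
      _ ≤ _ := by
        rw [Submodule.sup_mul, ← pow_succ']
        refine sup_le (sup_le le_sup_left ?_) le_sup_right
        refine le_trans ?_ le_sup_right
        have : a + 1 + 1 = 2 + a := by omega
        rw [this, pow_add]
        exact mul_le_mul_right hXa _

/-- If `J` is generated modulo `J ^ 2` by elements `x i` with `x i ^ q = 0` that commute modulo
`J ^ 3`, then the powers of `J` stabilise from the exponent `card ι * q` on. -/
lemma pow_card_mul_le_pow_succ {ι : Type*} [Fintype ι] [Nonempty ι] {J : Submodule F R}
    {x : ι → R} {q : ℕ} (hx : ∀ i, x i ∈ J) (hJ : J ≤ Submodule.span F (Set.range x) ⊔ J ^ 2)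
    (hc : ∀ i j, x i * x j - x j * x i ∈ J ^ 3) (hq : ∀ i, x i ^ q = 0) :
    J ^ (Fintype.card ι * q) ≤ J ^ (Fintype.card ι * q + 1) := by
  classical
  have hXJ : Submodule.span F (Set.range x) ≤ J := by
    rw [Submodule.span_le]; rintro _ ⟨i, rfl⟩; exact hx i
  refine (pow_le_span_pow_sup hXJ hJ _).trans (sup_le ?_ le_rfl)
  rw [Submodule.span_pow, Submodule.span_le]
  intro y hy
  obtain ⟨f, rfl⟩ := Set.mem_pow.mp hy
  choose g hg using fun i => (f i).2
  set l : List ι := List.ofFn g with hl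
  have hlen : l.length = Fintype.card ι * q := by simp [hl]
  have hprod : (List.ofFn fun i => (f i : R)) = l.map x := by
    rw [hl, List.map_ofFn]; congr 1; funext i; exact (hg i).symm
  rw [hprod]
  -- By pigeonhole some index occurs at least `q` times; moved to the front, these factors form `x i
  -- ^ q = 0`.
  obtain ⟨i, hi⟩ := List.exists_le_count_of_length_eq hlen
  obtain ⟨l', hl'⟩ := (List.replicate_sublist_iff.mpr hi).exists_perm_append
  have key := (hl'.map x).prod_sub_prod_mem_pow (J := J) (X := Set.range x)
    (by rintro _ ⟨i, rfl⟩; exact hx i) (by rintro _ ⟨i, rfl⟩ _ ⟨j, rfl⟩; exact hc i j)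
    (by intro y hy; obtain ⟨j, -, rfl⟩ := List.mem_map.mp hy; exact ⟨j, rfl⟩)
  simpa [hq, hlen] using key

end Words

/-! ### Augmentation ideals of group algebras and of finite `p`-groups. -/

section Augmentation

open MonoidAlgebra

variable (F : Type*) [Field F] (P : Type*) [Group P]

/-- The augmentation ideal of the group algebra `F[P]`, as an `F`-subspace. -/
noncomputable def augIdeal : Submodule F (MonoidAlgebra F P) :=
  Submodule.span F (Set.range fun g : P => of F P g - 1)

variable {F P}

lemma of_sub_one_mem_augIdeal (g : P) : of F P g - 1 ∈ augIdeal F P :=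
  Submodule.subset_span ⟨g, rfl⟩

lemma of_sub_of_mem_augIdeal (g h : P) : of F P g - of F P h ∈ augIdeal F P := by
  simpa using Submodule.sub_mem _ (of_sub_one_mem_augIdeal (F := F) g)
    (of_sub_one_mem_augIdeal h)

/-- The kernel of the map on group algebras induced by `f` is spanned by the differences
of group elements with the same image. -/
lemma mem_span_of_mapDomain_eq_zero {Q : Type*} [Group Q] (f : P →* Q) (x : MonoidAlgebra F P)
    (hx : mapDomainAlgHom F F f x = 0) :
    x ∈ Submodule.span F {y | ∃ g h : P, f g = f h ∧ y = of F P g - of F P h} := by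
  set S := Submodule.span F {y | ∃ g h : P, f g = f h ∧ y = of F P g - of F P h}
  let s : Q → P := Function.invFun f
  have hs : ∀ g, f (s (f g)) = f g := fun g => Function.invFun_eq ⟨g, rfl⟩
  have key : ∀ y : MonoidAlgebra F P, y - mapDomain s (mapDomain f y) ∈ S := by
    intro y
    induction y using MonoidAlgebra.induction_linear with
    | zero => simp
    | add y z hy hz =>
      rw [mapDomain_add, mapDomain_add, add_sub_add_comm]
      exact S.add_mem hy hz
    | single g a =>
      have : single g a - mapDomain s (mapDomain f (single g a)) =
          a • (of F P g - of F P (s (f g))) := by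
        simp [mapDomain_single, smul_sub]
      rw [this]
      exact S.smul_mem _ (Submodule.subset_span ⟨_, _, (hs g).symm, rfl⟩)
  have h0 := key x
  have hx' : mapDomain f x = 0 := hx
  rwa [hx', mapDomain_zero, sub_zero] at h0

lemma augIdeal_mul_mem {x : MonoidAlgebra F P} (hx : x ∈ augIdeal F P) (y : MonoidAlgebra F P) :
    x * y ∈ augIdeal F P := by
  induction hx using Submodule.span_induction with
  | zero => simp
  | add a b _ _ ha hb => rw [add_mul]; exact Submodule.add_mem _ ha hb
  | smul c a _ ha => rw [smul_mul_assoc]; exact Submodule.smul_mem _ _ ha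
  | mem a ha =>
    obtain ⟨g, rfl⟩ := ha
    induction y using MonoidAlgebra.induction_linear with
    | zero => simp
    | add y z hy hz => rw [mul_add]; exact Submodule.add_mem _ hy hz
    | single h a =>
      have : (of F P g - 1) * single h a = a • (of F P (g * h) - of F P h) := by
        simp [sub_mul, smul_sub, single_mul_single]
      beta_reduce
      rw [this]
      exact Submodule.smul_mem _ _ (of_sub_of_mem_augIdeal _ _)

/-- The exponent is `k + 1` because the zeroth power is the line `F · 1`, which is not an ideal in
general. -/
lemma augIdeal_pow_mul_mem {k : ℕ} {x : MonoidAlgebra F P} (hx : x ∈ augIdeal F P ^ (k + 1))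
    (y : MonoidAlgebra F P) : x * y ∈ augIdeal F P ^ (k + 1) := by
  rw [pow_succ] at hx ⊢
  induction hx using Submodule.mul_induction_on' with
  | mem_mul_mem a ha b hb =>
    rw [mul_assoc]; exact Submodule.mul_mem_mul ha (augIdeal_mul_mem hb y)
  | add a _ b _ ha hb => rw [add_mul]; exact Submodule.add_mem _ ha hb

lemma augIdeal_pow_anti {j k : ℕ} (h : j + 1 ≤ k) : augIdeal F P ^ k ≤ augIdeal F P ^ (j + 1) := by
  obtain ⟨m, rfl⟩ := Nat.exists_eq_add_of_le h
  rw [pow_add, Submodule.mul_le]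
  exact fun a ha b _ => augIdeal_pow_mul_mem ha b

/-- By `[gh] - 1 = ([g] - 1)[h] + ([h] - 1)`, the `g` with `[g] - 1` in a given right ideal form a
subgroup. -/
lemma of_sub_one_mem_augIdeal_pow_of_mem_closure {k : ℕ} {S : Set P}
    (hS : ∀ g ∈ S, of F P g - 1 ∈ augIdeal F P ^ (k + 1)) {g : P} (hg : g ∈ Subgroup.closure S) :
    of F P g - 1 ∈ augIdeal F P ^ (k + 1) := by
  induction hg using Subgroup.closure_induction with
  | mem g hg => exact hS g hg
  | one => rw [map_one, sub_self]; exact zero_mem _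
  | mul g h _ _ hg hh =>
    have : of F P (g * h) - 1 = (of F P g - 1) * of F P h + (of F P h - 1) := by
      rw [map_mul]; noncomm_ring
    rw [this]
    exact Submodule.add_mem _ (augIdeal_pow_mul_mem hg _) hh
  | inv g _ hg =>
    have : of F P g⁻¹ - 1 = -((of F P g - 1) * of F P g⁻¹) := by
      rw [sub_mul, ← map_mul, mul_inv_cancel, map_one]; noncomm_ring
    rw [this]
    exact Submodule.neg_mem _ (augIdeal_pow_mul_mem hg _)

/-- Modulo the square of the ideal, `g ↦ [g] - 1` turns products into sums. -/
lemma augIdeal_le_span_sup_sq {S : Set P} (hS : Subgroup.closure S = ⊤) :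
    augIdeal F P ≤ Submodule.span F ((fun g => of F P g - 1) '' S) ⊔ augIdeal F P ^ 2 := by
  rw [augIdeal, Submodule.span_le, ← augIdeal]
  rintro _ ⟨g, rfl⟩
  have hsq : ∀ g h : P, (of F P g - 1) * (of F P h - 1) ∈
      Submodule.span F ((fun g => of F P g - 1) '' S) ⊔ augIdeal F P ^ 2 := fun g h => by
    refine Submodule.mem_sup_right ?_
    rw [sq]
    exact Submodule.mul_mem_mul (of_sub_one_mem_augIdeal _) (of_sub_one_mem_augIdeal _)
  have hg : g ∈ Subgroup.closure S := hS ▸ Subgroup.mem_top g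
  beta_reduce
  induction hg using Subgroup.closure_induction with
  | mem g hg => exact Submodule.mem_sup_left (Submodule.subset_span ⟨g, hg, rfl⟩)
  | one => rw [map_one, sub_self]; exact zero_mem _
  | mul g h _ _ hg hh =>
    have : of F P (g * h) - 1 =
        (of F P g - 1) + (of F P h - 1) + (of F P g - 1) * (of F P h - 1) := by
      rw [map_mul]; noncomm_ring
    rw [this]
    exact add_mem (add_mem hg hh) (hsq g h)
  | inv g _ hg =>
    have : of F P g⁻¹ - 1 = -(of F P g - 1) - (of F P g - 1) * (of F P g⁻¹ - 1) := by
      rw [mul_sub, sub_mul, ← map_mul, mul_inv_cancel, map_one]; noncomm_ring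
    rw [this]
    exact sub_mem (neg_mem hg) (hsq g g⁻¹)

variable (p : ℕ) [Fact p.Prime] [CharP F p]

/-- A finite nonzero module over the group algebra of a `p`-group in characteristic `p` has a
nonzero invariant vector. -/
lemma IsPGroup.exists_ne_zero_forall_of_smul_eq (hP : IsPGroup p P)
    (N : Type*) [AddCommGroup N] [Module (MonoidAlgebra F P) N] [Finite N] [Nontrivial N] :
    ∃ v : N, v ≠ 0 ∧ ∀ g : P, of F P g • v = v := by
  let _ : MulAction P N := MulAction.compHom N (of F P)
  have hp0 : ∀ v : N, p • v = 0 := fun v => by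
    have h : ((p : ℕ) : MonoidAlgebra F P) = 0 := by
      rw [← map_natCast (algebraMap F (MonoidAlgebra F P)), CharP.cast_eq_zero, map_zero]
    rw [← Nat.cast_smul_eq_nsmul (MonoidAlgebra F P), h, zero_smul]
  have hdvd : p ∣ Nat.card N := by
    obtain ⟨v, hv⟩ := exists_ne (0 : N)
    rw [← addOrderOf_eq_prime (hp0 v) hv]
    exact addOrderOf_dvd_natCard v
  obtain ⟨v, hv, hne⟩ := hP.exists_fixed_point_of_prime_dvd_card_of_fixed_point N hdvd
    (a := (0 : N)) (fun g => smul_zero (of F P g))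
  exact ⟨v, fun h => hne h.symm, fun g => hv g⟩

lemma augIdeal_smul_eq_zero {N : Type*} [AddCommGroup N] [Module (MonoidAlgebra F P) N] {v : N}
    (hv : ∀ g : P, of F P g • v = v) {x : MonoidAlgebra F P} (hx : x ∈ augIdeal F P) :
    x • v = 0 := by
  induction hx using Submodule.span_induction with
  | zero => simp
  | add a b _ _ ha hb => rw [add_smul, ha, hb, add_zero]
  | smul c a _ ha => rw [Algebra.smul_def, mul_smul, ha, smul_zero]
  | mem a ha => obtain ⟨g, rfl⟩ := ha; rw [sub_smul, hv, one_smul, sub_self]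

/-- A power of the augmentation ideal of a `p`-group in characteristic `p` kills a given finite
module. -/
lemma IsPGroup.exists_augIdeal_pow_smul_eq_zero (hP : IsPGroup p P) (m : ℕ) :
    ∀ (N : Type*) [AddCommGroup N] [Module (MonoidAlgebra F P) N] [Finite N], Nat.card N ≤ m →
      ∃ k : ℕ, ∀ x ∈ augIdeal F P ^ k, ∀ v : N, x • v = 0 := by
  induction m with
  | zero => intro N _ _ _ h; exact absurd h (by simpa using Nat.card_pos.ne')
  | succ m ih =>
    intro N _ _ _ h
    rcases subsingleton_or_nontrivial N with hN | hN
    · exact ⟨0, fun _ _ _ => Subsingleton.elim _ _⟩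
    obtain ⟨v, hv0, hv⟩ := hP.exists_ne_zero_forall_of_smul_eq p (F := F) N
    -- The augmentation ideal kills the submodule generated by an invariant vector, so one more
    -- factor suffices beyond what kills `N ⧸ W`.
    set W : Submodule (MonoidAlgebra F P) N := Submodule.span _ {v}
    have : Finite (N ⧸ W) := Finite.of_surjective _ W.mkQ_surjective
    have hcard : Nat.card (N ⧸ W) < Nat.card N := by
      have h1 := W.card_eq_card_quotient_mul_card
      have : Nontrivial W :=
        ⟨⟨⟨v, Submodule.mem_span_singleton_self v⟩, 0, fun h => hv0 (congrArg Subtype.val h)⟩⟩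
      have h2 : 1 < Nat.card W := Finite.one_lt_card
      have h3 : 0 < Nat.card (N ⧸ W) := Nat.card_pos
      rw [h1]; nlinarith
    obtain ⟨k, hk⟩ := ih (N ⧸ W) (by omega)
    refine ⟨k + 1, fun x hx w => ?_⟩
    rw [pow_succ'] at hx
    induction hx using Submodule.mul_induction_on' with
    | mem_mul_mem a ha b hb =>
      have hbw : b • w ∈ W := by
        rw [← Submodule.Quotient.mk_eq_zero, Submodule.Quotient.mk_smul]; exact hk b hb _
      obtain ⟨c, hc⟩ := Submodule.mem_span_singleton.mp hbw
      rw [mul_smul, ← hc, ← mul_smul]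
      exact augIdeal_smul_eq_zero hv (augIdeal_mul_mem ha c)
    | add a _ b _ ha hb => rw [add_smul, ha, hb, add_zero]

lemma MonoidAlgebra.finite_of_finite (F P : Type*) [Field F] [Finite F] [Finite P] :
    Finite (MonoidAlgebra F P) :=
  have : Finite (P →₀ F) := Finite.of_injective _ DFunLike.coe_injective
  Finite.of_equiv _ (coeffEquiv (R := F) (M := P)).symm

lemma IsPGroup.exists_augIdeal_pow_eq_bot [Finite F] [Finite P] (hP : IsPGroup p P) :
    ∃ k : ℕ, augIdeal F P ^ k = ⊥ := by
  have := MonoidAlgebra.finite_of_finite F P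
  obtain ⟨k, hk⟩ := hP.exists_augIdeal_pow_smul_eq_zero p (F := F) _ (MonoidAlgebra F P) le_rfl
  exact ⟨k, (Submodule.eq_bot_iff _).mpr fun x hx => by simpa using hk x hx 1⟩

/-- The augmentation ideal of a finite `p`-group with generators `e i` of order dividing `p ^ s`,
whose commutators lie in the subgroup generated by the `e i ^ p`, vanishes in degree
`card ι * p ^ s`. -/
theorem augIdeal_pow_eq_bot [Finite F] [Finite P] (hp : 3 ≤ p) (hP : IsPGroup p P)
    {ι : Type*} [Fintype ι] [Nonempty ι] {e : ι → P} {s : ℕ}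
    (hgen : Subgroup.closure (Set.range e) = ⊤)
    (hcomm : ∀ i j, e i * e j * (e i)⁻¹ * (e j)⁻¹ ∈
      Subgroup.closure (Set.range fun i => e i ^ p))
    (hs : ∀ i, e i ^ p ^ s = 1) : augIdeal F P ^ (Fintype.card ι * p ^ s) = ⊥ := by
  have : CharP (MonoidAlgebra F P) p := charP_of_injective_algebraMap
    (algebraMap F (MonoidAlgebra F P)).injective p
  -- Frobenius in characteristic `p`, as `[g]` commutes with `1`.
  have hpow : ∀ (g : P) (k : ℕ), (of F P g - 1) ^ p ^ k = of F P (g ^ p ^ k) - 1 := fun g k => by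
    rw [sub_pow_char_pow_of_commute _ _ (Commute.one_right _), one_pow, map_pow]
  have hle : augIdeal F P ^ (Fintype.card ι * p ^ s) ≤
      augIdeal F P ^ (Fintype.card ι * p ^ s + 1) := by
    refine pow_card_mul_le_pow_succ (x := fun i => of F P (e i) - 1)
      (fun i => of_sub_one_mem_augIdeal _) ?_ (fun i j => ?_) fun i => ?_
    · have := augIdeal_le_span_sup_sq (F := F) hgen
      rwa [← Set.range_comp] at this
    -- With `x = [a] - 1` and `y = [b] - 1`, `xy - yx = ab - ba = ([a,b] - 1) ba`, so the commutator
    -- of group elements controls the commutator in the algebra.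
    · have h1 : (of F P (e i) - 1) * (of F P (e j) - 1) - (of F P (e j) - 1) * (of F P (e i) - 1) =
          (of F P (e i * e j * (e i)⁻¹ * (e j)⁻¹) - 1) * of F P (e j * e i) := by
        have : e i * e j * (e i)⁻¹ * (e j)⁻¹ * (e j * e i) = e i * e j := by group
        rw [sub_mul (of F P (_ * _)) 1, ← map_mul, this, map_mul, map_mul]; noncomm_ring
      rw [h1]
      refine augIdeal_pow_mul_mem (k := 2)
        (of_sub_one_mem_augIdeal_pow_of_mem_closure ?_ (hcomm i j)) _
      rintro _ ⟨l, rfl⟩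
      have := hpow (e l) 1
      rw [pow_one] at this
      rw [← this]
      -- A `p`-th power lies in degree `p`, and `p ≥ 3` places it in the cube.
      exact augIdeal_pow_anti (j := 2) hp (Submodule.pow_mem_pow _ (of_sub_one_mem_augIdeal _) p)
    · rw [hpow, hs, map_one, sub_self]
  have hle' : ∀ k, augIdeal F P ^ (Fintype.card ι * p ^ s) ≤
      augIdeal F P ^ (Fintype.card ι * p ^ s + k) := fun k => by
    induction k with
    | zero => rfl
    | succ k ih =>
      refine ih.trans ?_
      rw [pow_add, ← add_assoc, add_right_comm, pow_add _ _ k]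
      exact mul_le_mul_left hle _
  obtain ⟨k, hk⟩ := hP.exists_augIdeal_pow_eq_bot p (F := F)
  have := hle' k
  rwa [pow_add, hk, Submodule.mul_bot, le_bot_iff] at this

end Augmentation

/-! ### Compactness of completed group algebras -/

namespace completedGroupAlgebra

section Projections

variable (F : Type*) [Field F] {G : Type*} [Group G] [TopologicalSpace G]

/-- The projection `F[[G]] → F[G/N]`. -/
noncomputable def proj (N : OpenNormalSubgroup G) :
    completedGroupAlgebra F G →ₐ[F] MonoidAlgebra F (G ⧸ N.toSubgroup) :=
  (Pi.evalAlgHom F (fun N : OpenNormalSubgroup G => MonoidAlgebra F (G ⧸ N.toSubgroup)) N).comp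
    (completedGroupAlgebra F G).val

variable {F}

lemma proj_of (N : OpenNormalSubgroup G) (g : G) :
    proj F N (of F G g) = MonoidAlgebra.of F (G ⧸ N.toSubgroup) (QuotientGroup.mk g) := rfl

lemma map_proj {N N' : OpenNormalSubgroup G} (h : N.toSubgroup ≤ N'.toSubgroup)
    (x : completedGroupAlgebra F G) :
    MonoidAlgebra.mapDomainAlgHom F F
      (QuotientGroup.map N.toSubgroup N'.toSubgroup (MonoidHom.id G) h) (proj F N x) =
      proj F N' x := x.2 N N' h

lemma proj_eq_of_le {N N' : OpenNormalSubgroup G} (h : N.toSubgroup ≤ N'.toSubgroup)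
    {x y : completedGroupAlgebra F G} (hxy : proj F N x = proj F N y) :
    proj F N' x = proj F N' y := by
  rw [← map_proj h, hxy, map_proj h]

lemma ext_proj {x y : completedGroupAlgebra F G} (h : ∀ N, proj F N x = proj F N y) : x = y :=
  Subtype.ext (funext h)

variable (G) in
/-- The whole group as an open normal subgroup. -/
def openNormalTop : OpenNormalSubgroup G := ⟨⊤, inferInstanceAs (⊤ : Subgroup G).Normal⟩

variable (F G) in
/-- The augmentation ideal of `F[[G]]`, as an `F`-subspace. -/
noncomputable def aug : Submodule F (completedGroupAlgebra F G) :=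
  LinearMap.ker (proj F (openNormalTop G)).toLinearMap

/-- `aug` is defined at the trivial quotient only; compatibility with `F[G/N]` puts the projection
in the kernel of `F[G/N] → F[G/G]`, which is spanned by differences of group elements. -/
lemma proj_mem_augIdeal (N : OpenNormalSubgroup G) {x : completedGroupAlgebra F G}
    (hx : x ∈ aug F G) : proj F N x ∈ augIdeal F (G ⧸ N.toSubgroup) := by
  have h := map_proj (N := N) (N' := openNormalTop G) le_top x
  rw [show proj F (openNormalTop G) x = 0 from hx] at h
  refine Submodule.span_le.mpr ?_ (mem_span_of_mapDomain_eq_zero _ _ h)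
  rintro _ ⟨g, h, -, rfl⟩
  exact of_sub_of_mem_augIdeal g h

lemma proj_mem_augIdeal_pow (N : OpenNormalSubgroup G) {k : ℕ} {x : completedGroupAlgebra F G}
    (hx : x ∈ aug F G ^ k) : proj F N x ∈ augIdeal F (G ⧸ N.toSubgroup) ^ k := by
  have h1 : (aug F G ^ k).map (proj F N).toLinearMap ≤ augIdeal F (G ⧸ N.toSubgroup) ^ k := by
    rw [Submodule.map_pow]
    refine pow_le_pow_left' ?_ k
    rintro _ ⟨y, hy, rfl⟩
    exact proj_mem_augIdeal N hy
  exact h1 (Submodule.mem_map_of_mem hx)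

end Projections

/-! ### Compactness arguments over `F[[G]]`. -/

section Compact

variable {F : Type*} [Field F] {G : Type*} [Group G] [TopologicalSpace G]

/-- The discrete topology on a group algebra. -/
local instance discreteTopologicalSpace (P : Type*) : TopologicalSpace (MonoidAlgebra F P) := ⊥

local instance instDiscreteTopology (P : Type*) : DiscreteTopology (MonoidAlgebra F P) := ⟨rfl⟩

lemma continuous_proj (N : OpenNormalSubgroup G) : Continuous (proj F N) :=
  (continuous_apply N).comp continuous_subtype_val

lemma isClosed_carrier : IsClosed (completedGroupAlgebra F G :
    Set (∀ N : OpenNormalSubgroup G, MonoidAlgebra F (G ⧸ N.toSubgroup))) := by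
  have : (completedGroupAlgebra F G :
      Set (∀ N : OpenNormalSubgroup G, MonoidAlgebra F (G ⧸ N.toSubgroup))) =
      ⋂ (N : OpenNormalSubgroup G) (N' : OpenNormalSubgroup G)
        (h : N.toSubgroup ≤ N'.toSubgroup),
        {x | MonoidAlgebra.mapDomainAlgHom F F
          (QuotientGroup.map N.toSubgroup N'.toSubgroup (MonoidHom.id G) h) (x N) = x N'} := by
    ext x
    simp only [Set.mem_iInter]
    rfl
  rw [this]
  refine isClosed_iInter fun N => isClosed_iInter fun N' => isClosed_iInter fun h => ?_
  exact isClosed_eq (continuous_of_discreteTopology.comp (continuous_apply N))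
    (continuous_apply N')

variable [Finite F] (hG : ∀ N : OpenNormalSubgroup G, Finite (G ⧸ N.toSubgroup))

include hG

lemma compactSpace : CompactSpace (completedGroupAlgebra F G) := by
  have (N : OpenNormalSubgroup G) : Finite (MonoidAlgebra F (G ⧸ N.toSubgroup)) :=
    MonoidAlgebra.finite_of_finite F _
  exact isCompact_iff_compactSpace.mp isClosed_carrier.isCompact

/-- A finitely generated right ideal of `F[[G]]` is closed. -/
theorem exists_eq_sum_mul {ι : Type*} [Fintype ι] (h : ι → completedGroupAlgebra F G)
    (x : completedGroupAlgebra F G)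
    (hx : ∀ N : OpenNormalSubgroup G, ∃ y : ι → completedGroupAlgebra F G,
      proj F N x = proj F N (∑ i, h i * y i)) :
    ∃ y : ι → completedGroupAlgebra F G, x = ∑ i, h i * y i := by
  have := compactSpace (F := F) hG
  -- The solution sets modulo `N` are closed, nonempty and directed in a compact space; a common
  -- point solves the equation at every level.
  let S : OpenNormalSubgroup G → Set (ι → completedGroupAlgebra F G) :=
    fun N => {y | proj F N x = proj F N (∑ i, h i * y i)}
  have hclosed : ∀ N, IsClosed (S N) := fun N =>
    isClosed_eq continuous_const ((continuous_proj N).comp (by fun_prop))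
  have : Nonempty (OpenNormalSubgroup G) := ⟨openNormalTop G⟩
  obtain ⟨y, hy⟩ := IsCompact.nonempty_iInter_of_directed_nonempty_isCompact_isClosed S
    (fun N N' => ⟨N ⊓ N', fun y hy => proj_eq_of_le (N := N ⊓ N') inf_le_left hy,
      fun y hy => proj_eq_of_le (N := N ⊓ N') inf_le_right hy⟩)
    hx (fun N => (hclosed N).isCompact) hclosed
  exact ⟨y, ext_proj fun N => Set.mem_iInter.mp hy N⟩

/-- If `φ` is an endomorphism of a finitely generated module `M` with `⋂ φᵏ(M) = 0`, then some
power of `φ` maps `M` into `J M`, with `J` the augmentation ideal. -/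
theorem exists_pow_apply_mem_aug_smul {M : Type*} [AddCommGroup M] [Module F M]
    [Module (completedGroupAlgebra F G) M] [IsScalarTower F (completedGroupAlgebra F G) M]
    [Module.Finite (completedGroupAlgebra F G) M] (φ : Module.End (completedGroupAlgebra F G) M)
    (hφ : (⨅ k ≥ 1, LinearMap.range (φ ^ k)) = ⊥) :
    ∃ k : ℕ, ∀ m : M, (φ ^ k) m ∈ aug F G • (⊤ : Submodule F M) := by
  have := compactSpace (F := F) hG
  obtain ⟨d, s, hs⟩ := Module.Finite.exists_fin' (completedGroupAlgebra F G) M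
  -- `M` carries no topology here, so `φ` is lifted to a matrix on the free module, which is compact
  -- and on which linear maps are continuous.
  obtain ⟨A, hA⟩ := Module.projective_lifting_property s (φ ∘ₗ s) hs
  have hAk : ∀ (k : ℕ) (x : Fin d → completedGroupAlgebra F G),
      s ((A ^ k) x) = (φ ^ k) (s x) := fun k => by
    induction k with
    | zero => intro x; rfl
    | succ k ih =>
      intro x
      rw [pow_succ, pow_succ, Module.End.mul_apply, Module.End.mul_apply, ih]
      exact congrArg _ (LinearMap.congr_fun hA x)
  have hcont : ∀ B : Module.End (completedGroupAlgebra F G) (Fin d → completedGroupAlgebra F G),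
      Continuous B := fun B => by
    refine continuous_pi fun j => ?_
    have : (fun x => B x j) = fun x => ∑ i, x i * B (fun j => if i = j then 1 else 0) j := by
      funext x
      conv_lhs => rw [pi_eq_sum_univ x, map_sum, Finset.sum_apply]
      refine Finset.sum_congr rfl fun i _ => ?_
      rw [map_smul, Pi.smul_apply, smul_eq_mul]
    rw [this]
    exact continuous_finsetSum _ fun i _ => (continuous_apply i).mul continuous_const
  let W : AddSubgroup (Fin d → completedGroupAlgebra F G) :=
    (aug F G • (⊤ : Submodule F M)).toAddSubgroup.comap s.toAddMonoidHom
  have hW : IsOpen (W : Set (Fin d → completedGroupAlgebra F G)) := by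
    refine W.isOpen_of_mem_nhds (g := 0) (Filter.mem_of_superset (IsOpen.mem_nhds
      (s := Set.pi Set.univ fun _ : Fin d => (aug F G : Set (completedGroupAlgebra F G))) ?_ ?_) ?_)
    · exact isOpen_set_pi Set.finite_univ fun _ _ =>
        (isOpen_discrete {(0 : MonoidAlgebra F _)}).preimage (continuous_proj _)
    · exact fun i _ => (aug F G).zero_mem
    · intro x hx
      change s x ∈ aug F G • (⊤ : Submodule F M)
      rw [pi_eq_sum_univ x, map_sum]
      refine Submodule.sum_mem _ fun i _ => ?_
      rw [map_smul]
      exact Submodule.smul_mem_smul (hx i trivial) Submodule.mem_top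
  by_contra! hcon
  -- If no power of `φ` maps `M` into `J M`, these sets are nonempty, compact and decreasing. A
  -- common point `x` has `s x` in every `φᵏ(M)`, so `s x = 0`, although `x ∉ W`.
  let S : ℕ → Set (Fin d → completedGroupAlgebra F G) := fun k =>
    Set.range (fun x => (A ^ k) x) \ (W : Set (Fin d → completedGroupAlgebra F G))
  obtain ⟨x, hx⟩ := IsCompact.nonempty_iInter_of_sequence_nonempty_isCompact_isClosed S
    (fun k => Set.sdiff_subset_sdiff_left (by
      rintro _ ⟨y, rfl⟩; exact ⟨A y, by rw [pow_succ]; rfl⟩))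
    (fun k => by
      obtain ⟨m, hm⟩ := hcon k
      obtain ⟨y, rfl⟩ := hs m
      exact ⟨(A ^ k) y, ⟨y, rfl⟩, fun h => hm (hAk k y ▸ h)⟩)
    ((isCompact_range (hcont _)).diff hW)
    (fun k => ((isCompact_range (hcont _)).diff hW).isClosed)
  rw [Set.mem_iInter] at hx
  refine (hx 0).2 ?_
  have h0 : s x ∈ (⨅ k ≥ 1, LinearMap.range (φ ^ k)) := by
    simp only [Submodule.mem_iInf]
    intro k _
    obtain ⟨y, hy⟩ := (hx k).1
    exact ⟨s y, (hAk k y).symm.trans (congrArg s hy)⟩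
  rw [hφ, Submodule.mem_bot] at h0
  change s x ∈ aug F G • (⊤ : Submodule F M)
  rw [h0]
  exact Submodule.zero_mem _

/-- If `h i ∈ N` are elements whose images generate that of `N` in every finite quotient, then the
kernel of `F[[G]] → F[G/N]` is the right ideal generated by the `[h i] - 1`. -/
theorem exists_eq_sum_of_proj_eq_zero {ι : Type*} [Fintype ι] (N : OpenNormalSubgroup G)
    (h : ι → G) (hh : ∀ N' : OpenNormalSubgroup G, N.toSubgroup ≤
      Subgroup.closure (Set.range h) ⊔ N'.toSubgroup)
    (x : completedGroupAlgebra F G) (hx : proj F N x = 0) :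
    ∃ y : ι → completedGroupAlgebra F G, x = ∑ i, (of F G (h i) - 1) * y i := by
  refine exists_eq_sum_mul hG _ x fun N' => ?_
  -- Passing to a level inside `N` makes the kernel of `F[G/L] → F[G/N]` available.
  suffices H : ∃ y : ι → completedGroupAlgebra F G,
      proj F (N ⊓ N') x = proj F (N ⊓ N') (∑ i, (of F G (h i) - 1) * y i) by
    obtain ⟨y, hy⟩ := H
    exact ⟨y, proj_eq_of_le (N := N ⊓ N') inf_le_right hy⟩
  have hle : (N ⊓ N').toSubgroup ≤ N.toSubgroup := inf_le_left
  have hh' := hh (N ⊓ N')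
  generalize N ⊓ N' = L at hle hh' ⊢
  -- The image in `F[G/L]` of the right ideal generated by the `[h i] - 1`. It contains `[g] - 1`
  -- for every `g ∈ N`, and then every `[a] - [b] = ([a b⁻¹] - 1)[b]` with `a b⁻¹ ∈ N`.
  let I : Submodule F (MonoidAlgebra F (G ⧸ L.toSubgroup)) :=
    { carrier := {z | ∃ y : ι → completedGroupAlgebra F G,
        z = proj F L (∑ i, (of F G (h i) - 1) * y i)}
      zero_mem' := ⟨0, by simp⟩
      add_mem' := by
        rintro _ _ ⟨y, rfl⟩ ⟨z, rfl⟩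
        exact ⟨y + z, by simp [mul_add, Finset.sum_add_distrib]⟩
      smul_mem' := by
        rintro c _ ⟨y, rfl⟩
        refine ⟨c • y, ?_⟩
        rw [← map_smul, Finset.smul_sum]
        simp only [Pi.smul_apply, mul_smul_comm] }
  have hImul : ∀ z ∈ I, ∀ g : G, z * proj F L (of F G g) ∈ I := by
    rintro _ ⟨y, rfl⟩ g
    refine ⟨fun i => y i * of F G g, ?_⟩
    rw [← map_mul, Finset.sum_mul]
    simp only [mul_assoc]
  have hcl : ∀ g ∈ Subgroup.closure (Set.range h), proj F L (of F G g) - 1 ∈ I := by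
    intro g hg
    induction hg using Subgroup.closure_induction with
    | mem g hg =>
      classical
      obtain ⟨i, rfl⟩ := hg
      refine ⟨Pi.single i 1, ?_⟩
      simp [Pi.single_apply]
    | one => rw [map_one, map_one, sub_self]; exact I.zero_mem
    | mul a b _ _ ha hb =>
      have : proj F L (of F G (a * b)) - 1 =
          (proj F L (of F G a) - 1) * proj F L (of F G b) + (proj F L (of F G b) - 1) := by
        rw [map_mul, map_mul]; noncomm_ring
      rw [this]
      exact I.add_mem (hImul _ ha _) hb
    | inv a _ ha =>
      have : proj F L (of F G a⁻¹) - 1 =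
          -((proj F L (of F G a) - 1) * proj F L (of F G a⁻¹)) := by
        rw [sub_mul, ← map_mul, ← map_mul, mul_inv_cancel, map_one, map_one]; noncomm_ring
      rw [this]
      exact I.neg_mem (hImul _ ha _)
  have hN : ∀ g ∈ N.toSubgroup, proj F L (of F G g) - 1 ∈ I := by
    intro g hg
    obtain ⟨a, ha, b, hb, rfl⟩ := Subgroup.mem_sup_of_normal_right.mp (hh' hg)
    have : proj F L (of F G (a * b)) = proj F L (of F G a) := by
      rw [proj_of, proj_of, QuotientGroup.mk_mul_of_mem _ hb]
    rw [this]
    exact hcl a ha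
  have hspan := mem_span_of_mapDomain_eq_zero
    (QuotientGroup.map L.toSubgroup N.toSubgroup (MonoidHom.id G) hle) (proj F L x)
    (by rw [map_proj, hx])
  refine (Submodule.span_le (p := I)).mpr ?_ hspan
  rintro _ ⟨a, b, hab, rfl⟩
  obtain ⟨a, rfl⟩ := QuotientGroup.mk_surjective a
  obtain ⟨b, rfl⟩ := QuotientGroup.mk_surjective b
  have hmem : a * b⁻¹ ∈ N.toSubgroup := by
    have := QuotientGroup.eq.mp (show (a : G ⧸ N.toSubgroup) = b from hab)
    have h2 := N.isNormal'.conj_mem _ (N.toSubgroup.inv_mem this) b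
    simpa [mul_assoc] using h2
  have := hImul _ (hN _ hmem) b
  rwa [sub_mul, ← map_mul, ← map_mul, inv_mul_cancel_right, one_mul, proj_of, proj_of] at this

end Compact

end completedGroupAlgebra

/-! ### Congruence subgroups of `GL₂(ℤ_p)` and their topological generators -/

section Congruence

variable (p : ℕ) [Fact p.Prime]

/-- The principal congruence subgroup of level `p ^ N` of `GL₂(ℤ_p)`. -/
noncomputable def congrSubgroup (N : ℕ) : Subgroup (GL (Fin 2) ℤ_[p]) :=
  (Matrix.GeneralLinearGroup.map (n := Fin 2) (PadicInt.toZModPow (p := p) N)).ker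

variable {p}

lemma mem_congrSubgroup {N : ℕ} {g : GL (Fin 2) ℤ_[p]} :
    g ∈ congrSubgroup p N ↔
      ∀ i j, (p : ℤ_[p]) ^ N ∣ g i j - (1 : Matrix (Fin 2) (Fin 2) ℤ_[p]) i j := by
  rw [congrSubgroup, MonoidHom.mem_ker, Matrix.GeneralLinearGroup.ext_iff]
  refine forall_congr' fun i => forall_congr' fun j => ?_
  rw [Matrix.GeneralLinearGroup.map_apply, ← Ideal.mem_span_singleton, ← PadicInt.ker_toZModPow,
    RingHom.mem_ker, map_sub, sub_eq_zero]
  rcases eq_or_ne i j with rfl | h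
  · simp
  · simp [h]

lemma mem_congrSubgroup_iff_exists {N : ℕ} {g : GL (Fin 2) ℤ_[p]} :
    g ∈ congrSubgroup p N ↔ ∃ A : Matrix (Fin 2) (Fin 2) ℤ_[p],
      (g : Matrix (Fin 2) (Fin 2) ℤ_[p]) = 1 + (p : ℤ_[p]) ^ N • A := by
  rw [mem_congrSubgroup]
  constructor
  · intro h
    choose A hA using h
    refine ⟨Matrix.of A, ?_⟩
    ext i j
    rw [Matrix.add_apply, Matrix.smul_apply, Matrix.of_apply, smul_eq_mul, ← hA i j]
    ring
  · rintro ⟨A, hA⟩ i j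
    exact ⟨A i j, by rw [hA]; simp⟩

lemma mem_congrSubgroup_fin_two {N : ℕ} {g : GL (Fin 2) ℤ_[p]} :
    g ∈ congrSubgroup p N ↔ (p : ℤ_[p]) ^ N ∣ g 0 0 - 1 ∧ (p : ℤ_[p]) ^ N ∣ g 0 1 ∧
      (p : ℤ_[p]) ^ N ∣ g 1 0 ∧ (p : ℤ_[p]) ^ N ∣ g 1 1 - 1 := by
  simp [mem_congrSubgroup, Fin.forall_fin_two, and_assoc]

lemma congrSubgroup_one : congrSubgroup p 1 = K1 p := by
  ext g
  rw [mem_congrSubgroup, K1, MonoidHom.mem_ker, Matrix.GeneralLinearGroup.ext_iff]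
  refine forall_congr' fun i => forall_congr' fun j => ?_
  rw [Matrix.GeneralLinearGroup.map_apply, pow_one, ← Ideal.mem_span_singleton,
    ← Ideal.Quotient.eq_zero_iff_mem, map_sub, sub_eq_zero]
  rcases eq_or_ne i j with rfl | h
  · simp
  · simp [h]

lemma congrSubgroup_anti {m N : ℕ} (h : m ≤ N) : congrSubgroup p N ≤ congrSubgroup p m :=
  fun _ hg => mem_congrSubgroup.mpr fun i j =>
    (pow_dvd_pow _ h).trans (mem_congrSubgroup.mp hg i j)

/-- In `(1 + p ^ m A) ^ p` the middle terms carry an extra factor `p`, and the last one is divisible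
by `p ^ (m p)` with `m p ≥ m + 1`. -/
lemma pow_prime_mem_congrSubgroup {m : ℕ} (hm : 1 ≤ m) {g : GL (Fin 2) ℤ_[p]}
    (hg : g ∈ congrSubgroup p m) : g ^ p ∈ congrSubgroup p (m + 1) := by
  obtain ⟨A, hA⟩ := mem_congrSubgroup_iff_exists.mp hg
  obtain ⟨B, hB⟩ := (Commute.one_left ((p : ℤ_[p]) ^ m • A)).exists_add_pow_prime_eq
    (Fact.out : p.Prime)
  rw [mem_congrSubgroup_iff_exists]
  have hp2 : m + 1 ≤ m * p := by
    have := (Fact.out : p.Prime).two_le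
    nlinarith
  obtain ⟨k, hk⟩ := Nat.exists_eq_add_of_le hp2
  refine ⟨(p : ℤ_[p]) ^ k • A ^ p + A * B, ?_⟩
  rw [Units.val_pow_eq_pow_val, hA, hB, one_pow, mul_one, smul_pow, ← pow_mul, hk, pow_add, smul_add,
    add_assoc, mul_smul, ← nsmul_eq_mul, ← Nat.cast_smul_eq_nsmul ℤ_[p], smul_mul_assoc,
    smul_smul, smul_mul_assoc, smul_smul, pow_succ' _ m]

lemma pow_prime_pow_mem_congrSubgroup {g : GL (Fin 2) ℤ_[p]} (hg : g ∈ K1 p) (s : ℕ) :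
    g ^ p ^ s ∈ congrSubgroup p (s + 1) := by
  induction s with
  | zero => rwa [pow_zero, pow_one, zero_add, congrSubgroup_one]
  | succ s ih => rw [pow_succ, pow_mul]; exact pow_prime_mem_congrSubgroup (by omega) ih

/-- For `g = 1 + pA` and `h = 1 + pB`, `gh - hg = p² (AB - BA)`. -/
lemma commutator_mem_congrSubgroup {g h : GL (Fin 2) ℤ_[p]} (hg : g ∈ K1 p) (hh : h ∈ K1 p) :
    g * h * g⁻¹ * h⁻¹ ∈ congrSubgroup p 2 := by
  rw [← congrSubgroup_one] at hg hh
  obtain ⟨A, hA⟩ := mem_congrSubgroup_iff_exists.mp hg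
  obtain ⟨B, hB⟩ := mem_congrSubgroup_iff_exists.mp hh
  rw [mem_congrSubgroup_iff_exists]
  have h1 : ((g * h : GL (Fin 2) ℤ_[p]) : Matrix (Fin 2) (Fin 2) ℤ_[p]) =
      ((h * g : GL (Fin 2) ℤ_[p]) : Matrix (Fin 2) (Fin 2) ℤ_[p]) +
        (p : ℤ_[p]) ^ 2 • (A * B - B * A) := by
    rw [Units.val_mul, Units.val_mul, hA, hB]
    simp only [pow_one, add_mul, mul_add, one_mul, mul_one, smul_mul_assoc, mul_smul_comm,
      smul_add, smul_smul, smul_sub, sq]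
    abel
  refine ⟨(A * B - B * A) * ((h * g)⁻¹ : GL (Fin 2) ℤ_[p]), ?_⟩
  have h2 : g * h * g⁻¹ * h⁻¹ = g * h * (h * g)⁻¹ := by group
  rw [h2, Units.val_mul (g * h), h1, add_mul, smul_mul_assoc, ← Units.val_mul, mul_inv_cancel,
    Units.val_one]

lemma congrSubgroup_le_T1 {N : ℕ} {n : ℕ+} (h : (n : ℕ) ≤ N) : congrSubgroup p N ≤ T1 p n := by
  intro g hg
  obtain ⟨h1, h2, h3, h4⟩ := mem_congrSubgroup_fin_two.mp hg
  have hN : N ≠ 0 := by have := n.pos; omega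
  exact ⟨(dvd_pow_self _ hN).trans h1, (pow_dvd_pow _ h).trans h2, (pow_dvd_pow _ h).trans h3,
    (dvd_pow_self _ hN).trans h4⟩

/-! #### Generators -/

/-- The lower unipotent matrix with entry `x`. -/
noncomputable def lowerUnip (x : ℤ_[p]) : GL (Fin 2) ℤ_[p] :=
  ⟨!![1, 0; x, 1], !![1, 0; -x, 1], by simp [Matrix.one_fin_two], by simp [Matrix.one_fin_two]⟩

/-- The upper unipotent matrix with entry `x`. -/
noncomputable def upperUnip (x : ℤ_[p]) : GL (Fin 2) ℤ_[p] :=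
  ⟨!![1, x; 0, 1], !![1, -x; 0, 1], by simp [Matrix.one_fin_two], by simp [Matrix.one_fin_two]⟩

/-- The diagonal matrix with entries `u` and `v`. -/
noncomputable def diagUnit (u v : ℤ_[p]ˣ) : GL (Fin 2) ℤ_[p] :=
  ⟨!![(u : ℤ_[p]), 0; 0, v], !![((u⁻¹ : ℤ_[p]ˣ) : ℤ_[p]), 0; 0, (v⁻¹ : ℤ_[p]ˣ)],
    by simp [Matrix.one_fin_two], by simp [Matrix.one_fin_two]⟩

lemma lowerUnip_mul (x y : ℤ_[p]) : lowerUnip x * lowerUnip y = lowerUnip (x + y) :=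
  Units.ext (by simp [lowerUnip])

lemma upperUnip_mul (x y : ℤ_[p]) : upperUnip x * upperUnip y = upperUnip (x + y) :=
  Units.ext (by simp [upperUnip, add_comm])

lemma diagUnit_mul (u v u' v' : ℤ_[p]ˣ) :
    diagUnit u v * diagUnit u' v' = diagUnit (u * u') (v * v') :=
  Units.ext (by simp [diagUnit])

lemma lowerUnip_pow (x : ℤ_[p]) (k : ℕ) : lowerUnip x ^ k = lowerUnip ((k : ℤ_[p]) * x) := by
  induction k with
  | zero => exact Units.ext (by simp [lowerUnip, Matrix.one_fin_two])
  | succ k ih => rw [pow_succ, ih, lowerUnip_mul]; congr 1; push_cast; ring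

lemma upperUnip_pow (x : ℤ_[p]) (k : ℕ) : upperUnip x ^ k = upperUnip ((k : ℤ_[p]) * x) := by
  induction k with
  | zero => exact Units.ext (by simp [upperUnip, Matrix.one_fin_two])
  | succ k ih => rw [pow_succ, ih, upperUnip_mul]; congr 1; push_cast; ring

lemma diagUnit_pow (u v : ℤ_[p]ˣ) (k : ℕ) : diagUnit u v ^ k = diagUnit (u ^ k) (v ^ k) := by
  induction k with
  | zero => exact Units.ext (by simp [diagUnit, Matrix.one_fin_two])
  | succ k ih => rw [pow_succ, ih, diagUnit_mul, ← pow_succ, ← pow_succ]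

lemma isUnit_of_dvd_sub_one {a : ℤ_[p]} (h : (p : ℤ_[p]) ∣ a - 1) : IsUnit a := by
  by_contra ha
  have ha' : a ∈ IsLocalRing.maximalIdeal ℤ_[p] := ha
  rw [PadicInt.maximalIdeal_eq_span_p, Ideal.mem_span_singleton] at ha'
  exact PadicInt.prime_p.not_isUnit (isUnit_of_dvd_one (by simpa using dvd_sub ha' h))

variable (p) in
/-- The unit `1 + p` of `ℤ_p`. -/
noncomputable def onePlusP : ℤ_[p]ˣ :=
  (isUnit_of_dvd_sub_one (a := 1 + (p : ℤ_[p])) (by simp)).unit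

lemma val_onePlusP : ((onePlusP p : ℤ_[p]ˣ) : ℤ_[p]) = 1 + p := rfl

/-- `1 + p ^ (s + 1) ℤ_p` is topologically generated by `(1 + p) ^ (p ^ s)`. -/
lemma exists_pow_dvd_onePlusP_pow_sub (hp : 3 ≤ p) {s : ℕ} {u : ℤ_[p]}
    (hu : (p : ℤ_[p]) ^ (s + 1) ∣ u - 1) (N : ℕ) :
    ∃ k : ℕ, (p : ℤ_[p]) ^ N ∣ (1 + (p : ℤ_[p])) ^ (p ^ s * k) - u := by
  rcases le_total N (s + 1) with h | h
  · exact ⟨0, by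
      rw [mul_zero, pow_zero, ← dvd_neg, neg_sub]; exact (pow_dvd_pow _ h).trans hu⟩
  induction N, h using Nat.le_induction with
  | base => exact ⟨0, by rw [mul_zero, pow_zero, ← dvd_neg, neg_sub]; exact hu⟩
  | succ N hN ih =>
    obtain ⟨k, v, hv⟩ := ih
    obtain ⟨t, rfl⟩ : ∃ t, N = s + t + 1 := ⟨N - s - 1, by omega⟩
    obtain ⟨y, hy⟩ := ZMod.exists_one_add_mul_pow_prime_pow_eq (R := ℤ_[p]) (u := p) (v := p)
      (Fact.out : p.Prime) dvd_rfl
      (by rw [← sq, ← pow_succ]; exact pow_dvd_pow _ hp) 1 (s + t)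
    rw [mul_one] at hy
    -- Write the current power as `u + p ^ N v`. Multiplying by `(1 + p) ^ (p ^ (s + t) l)`, which
    -- is `1 + l p ^ N` modulo `p ^ (N + 1)`, changes `v` to `v + l` modulo `p` because `u ≡ 1`;
    -- hence the digit `l` of `-v`.
    have hvl := PadicInt.appr_spec 1 (-v)
    rw [pow_one, Ideal.mem_span_singleton] at hvl
    obtain ⟨w, hw⟩ := hvl
    set l : ℕ := (-v).appr 1
    obtain ⟨z, hz⟩ : ∃ z, (1 + (p : ℤ_[p])) ^ (p ^ (s + t) * l) =
        1 + (p : ℤ_[p]) ^ (s + t + 1) * (l + p * z) := by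
      rw [pow_mul, hy]
      obtain ⟨c, hc⟩ : ∃ c, (1 + (p : ℤ_[p]) ^ (s + t) * p * (1 + p * y)) ^ l =
          1 + l * ((p : ℤ_[p]) ^ (s + t) * p * (1 + p * y)) +
            c * ((p : ℤ_[p]) ^ (s + t) * p * (1 + p * y)) ^ 2 := by
        clear_value l
        generalize (p : ℤ_[p]) ^ (s + t) * p * (1 + p * y) = X
        clear hw
        induction l with
        | zero => exact ⟨0, by simp⟩
        | succ l ih =>
          obtain ⟨c, hc⟩ := ih
          exact ⟨c + c * X + l, by rw [pow_succ, hc]; push_cast; ring⟩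
      refine ⟨l * y + c * p ^ (s + t) * (1 + p * y) ^ 2, ?_⟩
      rw [hc, pow_succ]; ring
    obtain ⟨b, hb⟩ : (p : ℤ_[p]) ∣ u - 1 := (dvd_pow_self _ (by omega)).trans hu
    refine ⟨k + p ^ t * l, ?_⟩
    have e : p ^ s * (k + p ^ t * l) = p ^ s * k + p ^ (s + t) * l := by ring
    rw [e, pow_add (1 + (p : ℤ_[p])), hz]
    have hv' : (1 + (p : ℤ_[p])) ^ (p ^ s * k) = u + p ^ (s + t + 1) * v := by
      rw [← hv]; ring
    rw [hv']
    have hu' : u = 1 + p * b := by rw [← hb]; ring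
    have hl : (l : ℤ_[p]) = -v - p * w := by rw [← hw]; ring
    rw [hu', hl]
    refine ⟨-w + b * (-v - p * w) + z * (1 + p * b)
      + p ^ (s + t) * v * (-v - p * w + p * z), ?_⟩
    rw [pow_succ _ (s + t + 1), pow_succ _ (s + t)]
    ring

/-- A subgroup of `GL₂(ℤ_p)` containing some congruence subgroup contains the one of level
`p ^ (s + 1)` as soon as it contains the `p ^ s`-th powers of the standard generators. -/
theorem congrSubgroup_le_of_generators (hp : 3 ≤ p) {H : Subgroup (GL (Fin 2) ℤ_[p])} {N s : ℕ}
    (hN : congrSubgroup p N ≤ H) (hl : lowerUnip (p : ℤ_[p]) ^ p ^ s ∈ H)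
    (hu : upperUnip (p : ℤ_[p]) ^ p ^ s ∈ H) (hd₁ : diagUnit (onePlusP p) 1 ^ p ^ s ∈ H)
    (hd₂ : diagUnit 1 (onePlusP p) ^ p ^ s ∈ H) : congrSubgroup p (s + 1) ≤ H := by
  have happr : ∀ x : ℤ_[p], (p : ℤ_[p]) ^ (s + 1) ∣ x →
      ∃ (k : ℕ) (z : ℤ_[p]), x = ((p ^ s * k : ℕ) : ℤ_[p]) * p + p ^ N * z := by
    rintro _ ⟨y, rfl⟩
    have h := PadicInt.appr_spec N y
    rw [Ideal.mem_span_singleton] at h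
    obtain ⟨z, hz⟩ := h
    refine ⟨y.appr N, p ^ (s + 1) * z, ?_⟩
    have : y = y.appr N + p ^ N * z := by rw [← hz]; ring
    conv_lhs => rw [this]
    push_cast
    ring
  have hL : ∀ x : ℤ_[p], (p : ℤ_[p]) ^ (s + 1) ∣ x → lowerUnip x ∈ H := fun x hx => by
    obtain ⟨k, z, rfl⟩ := happr x hx
    rw [← lowerUnip_mul, ← lowerUnip_pow, pow_mul]
    exact H.mul_mem (H.pow_mem hl k)
      (hN (mem_congrSubgroup_fin_two.mpr (by simp [lowerUnip])))
  have hU : ∀ x : ℤ_[p], (p : ℤ_[p]) ^ (s + 1) ∣ x → upperUnip x ∈ H := fun x hx => by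
    obtain ⟨k, z, rfl⟩ := happr x hx
    rw [← upperUnip_mul, ← upperUnip_pow, pow_mul]
    exact H.mul_mem (H.pow_mem hu k)
      (hN (mem_congrSubgroup_fin_two.mpr (by simp [upperUnip])))
  have hunit : ∀ u : ℤ_[p]ˣ, (p : ℤ_[p]) ^ (s + 1) ∣ (u : ℤ_[p]) - 1 →
      ∃ (k : ℕ) (v : ℤ_[p]ˣ), u = onePlusP p ^ (p ^ s * k) * v ∧
        (p : ℤ_[p]) ^ N ∣ (v : ℤ_[p]) - 1 := fun u hu => by
    obtain ⟨k, w, hw⟩ := exists_pow_dvd_onePlusP_pow_sub hp hu N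
    refine ⟨k, (onePlusP p ^ (p ^ s * k))⁻¹ * u, by simp, ?_⟩
    have h1 : (((onePlusP p ^ (p ^ s * k))⁻¹ : ℤ_[p]ˣ) : ℤ_[p]) *
        (1 + (p : ℤ_[p])) ^ (p ^ s * k) = 1 := by
      rw [← val_onePlusP, ← Units.val_pow_eq_pow_val, Units.inv_mul]
    refine ⟨-(((onePlusP p ^ (p ^ s * k))⁻¹ : ℤ_[p]ˣ) : ℤ_[p]) * w, ?_⟩
    rw [Units.val_mul]
    linear_combination
      -(((onePlusP p ^ (p ^ s * k))⁻¹ : ℤ_[p]ˣ) : ℤ_[p]) * hw + h1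
  have hD₁ : ∀ u : ℤ_[p]ˣ, (p : ℤ_[p]) ^ (s + 1) ∣ (u : ℤ_[p]) - 1 → diagUnit u 1 ∈ H :=
    fun u hu => by
    obtain ⟨k, v, rfl, hv⟩ := hunit u hu
    have : diagUnit (onePlusP p ^ (p ^ s * k) * v) 1 =
        (diagUnit (onePlusP p) 1 ^ p ^ s) ^ k * diagUnit v 1 := by
      rw [← pow_mul, diagUnit_pow, diagUnit_mul, one_pow, one_mul]
    rw [this]
    exact H.mul_mem (H.pow_mem hd₁ k)
      (hN (mem_congrSubgroup_fin_two.mpr (by simpa [diagUnit] using hv)))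
  have hD₂ : ∀ u : ℤ_[p]ˣ, (p : ℤ_[p]) ^ (s + 1) ∣ (u : ℤ_[p]) - 1 → diagUnit 1 u ∈ H :=
    fun u hu => by
    obtain ⟨k, v, rfl, hv⟩ := hunit u hu
    have : diagUnit 1 (onePlusP p ^ (p ^ s * k) * v) =
        (diagUnit 1 (onePlusP p) ^ p ^ s) ^ k * diagUnit 1 v := by
      rw [← pow_mul, diagUnit_pow, diagUnit_mul, one_pow, one_mul]
    rw [this]
    exact H.mul_mem (H.pow_mem hd₂ k)
      (hN (mem_congrSubgroup_fin_two.mpr (by simpa [diagUnit] using hv)))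
  intro g hg
  obtain ⟨ha, hb, hc, hd⟩ := mem_congrSubgroup_fin_two.mp hg
  have hps : (p : ℤ_[p]) ∣ p ^ (s + 1) := dvd_pow_self _ (by omega)
  obtain ⟨a, haa⟩ := isUnit_of_dvd_sub_one (hps.trans ha)
  -- The Schur complement of the upper left entry, which is the second diagonal entry of the
  -- lower-diagonal-upper factorisation used below.
  have hdet : (p : ℤ_[p]) ^ (s + 1) ∣ g 1 1 - g 1 0 * ((a⁻¹ : ℤ_[p]ˣ) : ℤ_[p]) * g 0 1 - 1 := by
    rw [sub_right_comm]
    exact dvd_sub hd (hb.mul_left _)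
  obtain ⟨d, hdd⟩ := isUnit_of_dvd_sub_one (hps.trans hdet)
  have hfac : g = lowerUnip (g 1 0 * ((a⁻¹ : ℤ_[p]ˣ) : ℤ_[p])) * diagUnit a 1 * diagUnit 1 d *
      upperUnip (((a⁻¹ : ℤ_[p]ˣ) : ℤ_[p]) * g 0 1) := by
    refine Units.ext ?_
    rw [Matrix.eta_fin_two (g : Matrix (Fin 2) (Fin 2) ℤ_[p])]
    simp only [Units.val_mul, lowerUnip, upperUnip, diagUnit, Matrix.mul_fin_two, hdd]
    rw [← haa, Units.val_one]
    have h1 := Units.mul_inv a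
    generalize ((a⁻¹ : ℤ_[p]ˣ) : ℤ_[p]) = a' at h1 ⊢
    ext i j
    fin_cases i <;> fin_cases j <;>
      simp only [Matrix.of_apply, Matrix.cons_val', Matrix.cons_val_zero, Matrix.cons_val_one,
        Fin.zero_eta, Fin.mk_one, Fin.isValue, Matrix.cons_val_fin_one]
    · ring
    · linear_combination -(g 0 1) * h1
    · linear_combination -(g 1 0) * h1
    · linear_combination -(g 1 0 * a' * g 0 1) * h1
  rw [hfac]
  exact H.mul_mem (H.mul_mem (H.mul_mem (hL _ (hc.mul_right _)) (hD₁ _ (haa ▸ ha)))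
    (hD₂ _ (hdd ▸ hdet))) (hU _ (hb.mul_left _))

end Congruence

/-! ### The group `𝒦₁/𝒵₁` -/

section ProdCongruence

variable (p : ℕ) [Fact p.Prime] (r : ℕ)

/-- Reduction modulo `p ^ N` on `𝒦₁`. -/
noncomputable def prodReduction (N : ℕ) : ProdK1 p r →* (Fin r → GL (Fin 2) (ZMod (p ^ N))) :=
  MonoidHom.pi fun i => (Matrix.GeneralLinearGroup.map (PadicInt.toZModPow (p := p) N)).comp
    ((K1 p).subtype.comp (Pi.evalMonoidHom (fun _ => K1 p) i))

/-- The principal congruence subgroup of level `p ^ N` of `𝒦₁`. -/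
noncomputable def prodCongr (N : ℕ) : Subgroup (ProdK1 p r) := (prodReduction p r N).ker

instance prodCongr.normal (N : ℕ) : (prodCongr p r N).Normal := MonoidHom.normal_ker _

variable {p r}

lemma mem_prodCongr {N : ℕ} {g : ProdK1 p r} :
    g ∈ prodCongr p r N ↔ ∀ i, (g i : GL (Fin 2) ℤ_[p]) ∈ congrSubgroup p N := by
  rw [prodCongr, MonoidHom.mem_ker, funext_iff]
  rfl

lemma finite_quotient_prodCongr (N : ℕ) : Finite (ProdK1 p r ⧸ prodCongr p r N) :=
  Finite.of_injective _ (QuotientGroup.kerLift_injective (prodReduction p r N))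

lemma prodCongr_le_ProdT1 (n : Fin r → ℕ+) : prodCongr p r (kappa n) ≤ ProdT1 p n := by
  intro g hg i _
  exact Subgroup.mem_subgroupOf.mpr (congrSubgroup_le_T1
    (Finset.le_sup (f := fun i => (n i : ℕ)) (Finset.mem_univ i)) (mem_prodCongr.mp hg i))

lemma pow_mem_prodCongr (g : ProdK1 p r) (s : ℕ) : g ^ p ^ s ∈ prodCongr p r (s + 1) :=
  mem_prodCongr.mpr fun i => by
    rw [Pi.pow_apply, Subgroup.coe_pow]
    exact pow_prime_pow_mem_congrSubgroup (g i).2 s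

lemma commutator_mem_prodCongr (g h : ProdK1 p r) : g * h * g⁻¹ * h⁻¹ ∈ prodCongr p r 2 :=
  mem_prodCongr.mpr fun i => commutator_mem_congrSubgroup (g i).2 (h i).2

lemma prodCongr_one : prodCongr p r 1 = ⊤ :=
  eq_top_iff.mpr fun g _ => mem_prodCongr.mpr fun i => by
    rw [congrSubgroup_one]; exact (g i).2

/-! #### Topology -/

lemma continuous_entry (i : Fin r) (k l : Fin 2) :
    Continuous fun g : ProdK1 p r => (g i : GL (Fin 2) ℤ_[p]) k l :=
  (Units.continuous_val.comp (continuous_subtype_val.comp (continuous_apply i))).matrix_elem k l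

lemma isOpen_prodCongr (N : ℕ) : IsOpen (prodCongr p r N : Set (ProdK1 p r)) := by
  have : (prodCongr p r N : Set (ProdK1 p r)) = ⋂ (i : Fin r) (k : Fin 2) (l : Fin 2),
      {g | (g i : GL (Fin 2) ℤ_[p]) k l ∈
        Metric.closedBall ((1 : Matrix (Fin 2) (Fin 2) ℤ_[p]) k l) ((p : ℝ) ^ (-(N : ℤ)))} := by
    ext g
    simp only [SetLike.mem_coe, mem_prodCongr, mem_congrSubgroup, Set.mem_iInter,
      Set.mem_ofPred_eq, Metric.mem_closedBall, dist_eq_norm,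
      PadicInt.norm_le_pow_iff_mem_span_pow, Ideal.mem_span_singleton]
  rw [this]
  refine isOpen_iInter_of_finite fun i => isOpen_iInter_of_finite fun k =>
    isOpen_iInter_of_finite fun l => IsOpen.preimage (continuous_entry i k l) ?_
  exact IsUltrametricDist.isOpen_closedBall _
    (zpow_ne_zero _ (Nat.cast_ne_zero.mpr (Fact.out : p.Prime).ne_zero))

lemma tendsto_one_of_mem_congrSubgroup {g : ℕ → GL (Fin 2) ℤ_[p]}
    (hg : ∀ N, g N ∈ congrSubgroup p N) : Filter.Tendsto g Filter.atTop (nhds 1) := by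
  have key : ∀ g : ℕ → GL (Fin 2) ℤ_[p], (∀ N, g N ∈ congrSubgroup p N) →
      Filter.Tendsto (fun N => (g N : Matrix (Fin 2) (Fin 2) ℤ_[p])) Filter.atTop (nhds 1) := by
    intro g hg
    refine tendsto_pi_nhds.mpr fun k => tendsto_pi_nhds.mpr fun l => ?_
    rw [tendsto_iff_norm_sub_tendsto_zero]
    have hp1 : (1 : ℝ) < p := Nat.one_lt_cast.mpr (Fact.out : p.Prime).one_lt
    refine squeeze_zero (fun _ => norm_nonneg _) (fun N => ?_)
      (tendsto_pow_atTop_nhds_zero_of_lt_one (r := (p : ℝ)⁻¹) (by positivity)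
        (inv_lt_one_of_one_lt₀ hp1))
    have := (PadicInt.norm_le_pow_iff_mem_span_pow _ N).mpr
      (Ideal.mem_span_singleton.mpr (mem_congrSubgroup.mp (hg N) k l))
    rwa [zpow_neg, zpow_natCast, ← inv_pow] at this
  -- Convergence of units requires convergence of the inverses as well; these lie in the same
  -- congruence subgroups.
  rw [Units.isEmbedding_embedProduct.tendsto_nhds_iff, nhds_prod_eq]
  exact (key g hg).prodMk
    ((MulOpposite.continuous_op.tendsto _).comp (key (fun N => (g N)⁻¹) fun N => inv_mem (hg N)))

/-- Otherwise elements of ever deeper congruence subgroups outside `U` would form a sequence tending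
to `1`. -/
lemma exists_prodCongr_subset {U : Set (ProdK1 p r)} (hU : IsOpen U) (h1 : 1 ∈ U) :
    ∃ N, (prodCongr p r N : Set (ProdK1 p r)) ⊆ U := by
  by_contra! h
  choose g hg hgU using fun N => Set.not_subset.mp (h N)
  have : Filter.Tendsto g Filter.atTop (nhds 1) := by
    refine tendsto_pi_nhds.mpr fun i => ?_
    rw [Topology.IsEmbedding.subtypeVal.tendsto_nhds_iff]
    exact tendsto_one_of_mem_congrSubgroup fun N => mem_prodCongr.mp (hg N) i
  obtain ⟨N, hN⟩ := (this.eventually (hU.mem_nhds h1)).exists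
  exact hgU N hN

/-! #### Generators -/

variable (p) in
/-- The four standard generators of `K₁`. -/
noncomputable def K1gen : Fin 4 → K1 p :=
  ![⟨lowerUnip p, by
      rw [← congrSubgroup_one]; exact mem_congrSubgroup_fin_two.mpr (by simp [lowerUnip])⟩,
    ⟨upperUnip p, by
      rw [← congrSubgroup_one]; exact mem_congrSubgroup_fin_two.mpr (by simp [upperUnip])⟩,
    ⟨diagUnit (onePlusP p) 1, by
      rw [← congrSubgroup_one]
      exact mem_congrSubgroup_fin_two.mpr (by simp [diagUnit, val_onePlusP])⟩,
    ⟨diagUnit 1 (onePlusP p), by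
      rw [← congrSubgroup_one]
      exact mem_congrSubgroup_fin_two.mpr (by simp [diagUnit, val_onePlusP])⟩]

variable (p r) in
/-- The standard generators of `𝒦₁`. -/
noncomputable def prodGen (x : Fin r × Fin 4) : ProdK1 p r := Pi.mulSingle x.1 (K1gen p x.2)

/-- Reduces to one factor: an element of the product lies in `H` once each of its coordinates,
placed alone, does. -/
theorem prodCongr_le_of_generators (hp : 3 ≤ p) {H : Subgroup (ProdK1 p r)} {N s : ℕ}
    (hN : prodCongr p r N ≤ H) (hgen : ∀ x, prodGen p r x ^ p ^ s ∈ H) :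
    prodCongr p r (s + 1) ≤ H := by
  intro g hg
  refine Subgroup.pi_mem_of_mulSingle_mem g fun i => ?_
  set H' : Subgroup (GL (Fin 2) ℤ_[p]) :=
    (H.comap (MonoidHom.mulSingle (fun _ : Fin r => K1 p) i)).map (K1 p).subtype
  have hgen' : ∀ j, (K1gen p j : GL (Fin 2) ℤ_[p]) ^ p ^ s ∈ H' := fun j =>
    ⟨K1gen p j ^ p ^ s, by
      have := hgen (i, j)
      rw [prodGen, ← Pi.mulSingle_pow] at this
      exact this, rfl⟩
  -- Level `N + 1` rather than `N`, so that the elements lie in `K₁` even when `N = 0`.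
  have hN' : congrSubgroup p (N + 1) ≤ H' := fun x hx => by
    have hx1 : x ∈ K1 p := by
      rw [← congrSubgroup_one]; exact congrSubgroup_anti (by omega) hx
    refine ⟨⟨x, hx1⟩, hN (mem_prodCongr.mpr fun k => ?_), rfl⟩
    rcases eq_or_ne k i with rfl | h
    · simpa using congrSubgroup_anti (Nat.le_succ N) hx
    · simp [Pi.mulSingle_eq_of_ne h]
  obtain ⟨y, hy, hyg⟩ := congrSubgroup_le_of_generators hp hN' (hgen' 0) (hgen' 1) (hgen' 2)
    (hgen' 3) (mem_prodCongr.mp hg i)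
  have : y = g i := Subtype.ext hyg
  exact this ▸ hy

/-! #### The quotient by the centre -/

variable (p r) in
/-- The image of the congruence subgroup of level `p ^ N` in `𝒦₁/𝒵₁`. -/
noncomputable def quotCongr (N : ℕ) : OpenNormalSubgroup (ProdK1 p r ⧸ ProdZ1 p r) where
  toSubgroup := (prodCongr p r N).map (QuotientGroup.mk' (ProdZ1 p r))
  isOpen' := QuotientGroup.isOpenMap_coe _ (isOpen_prodCongr N)
  isNormal' := (prodCongr.normal p r N).map _ (QuotientGroup.mk'_surjective _)

lemma exists_prodCongr_le_comap (L : OpenNormalSubgroup (ProdK1 p r ⧸ ProdZ1 p r)) :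
    ∃ N, prodCongr p r N ≤ L.toSubgroup.comap (QuotientGroup.mk' (ProdZ1 p r)) :=
  exists_prodCongr_subset
    (U := QuotientGroup.mk' (ProdZ1 p r) ⁻¹' (L.toSubgroup : Set (ProdK1 p r ⧸ ProdZ1 p r)))
    (L.isOpen'.preimage QuotientGroup.continuous_mk) (one_mem L.toSubgroup)

lemma finite_quotient_openNormal (L : OpenNormalSubgroup (ProdK1 p r ⧸ ProdZ1 p r)) :
    Finite ((ProdK1 p r ⧸ ProdZ1 p r) ⧸ L.toSubgroup) := by
  obtain ⟨N, hN⟩ := exists_prodCongr_le_comap L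
  have := finite_quotient_prodCongr (p := p) (r := r) N
  refine Finite.of_surjective (QuotientGroup.map (prodCongr p r N) L.toSubgroup
    (QuotientGroup.mk' (ProdZ1 p r)) hN) fun x => ?_
  obtain ⟨x, rfl⟩ := QuotientGroup.mk_surjective x
  obtain ⟨x, rfl⟩ := QuotientGroup.mk_surjective x
  exact ⟨x, rfl⟩

variable (p r) in
/-- The images of the standard generators in `𝒦₁/𝒵₁`. -/
noncomputable def quotGen (x : Fin r × Fin 4) : ProdK1 p r ⧸ ProdZ1 p r :=
  QuotientGroup.mk' (ProdZ1 p r) (prodGen p r x)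

/-- The `p ^ s`-th powers of the generators generate the image of the congruence subgroup of level
`p ^ (s + 1)` topologically. -/
theorem quotCongr_le_closure_sup (hp : 3 ≤ p) (s : ℕ)
    (L : OpenNormalSubgroup (ProdK1 p r ⧸ ProdZ1 p r)) :
    (quotCongr p r (s + 1)).toSubgroup ≤
      Subgroup.closure (Set.range fun x => quotGen p r x ^ p ^ s) ⊔ L.toSubgroup := by
  obtain ⟨N, hN⟩ := exists_prodCongr_le_comap L
  refine Subgroup.map_le_iff_le_comap.mpr (prodCongr_le_of_generators hp
    (hN.trans (Subgroup.comap_mono le_sup_right)) fun x => Subgroup.mem_sup_left ?_)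
  exact Subgroup.subset_closure ⟨x, by rw [map_pow]; rfl⟩

variable (F : Type*) [Field F] [Finite F] [CharP F p]

/-- The augmentation ideal of the finite quotient of `𝒦₁/𝒵₁` of level `p ^ (s + 1)` vanishes in
degree `4 r p ^ s`. -/
theorem augIdeal_quotCongr_pow_eq_bot (hp : 3 ≤ p) (hr : 1 ≤ r) (s : ℕ) :
    augIdeal F ((ProdK1 p r ⧸ ProdZ1 p r) ⧸ (quotCongr p r (s + 1)).toSubgroup) ^
      (r * 4 * p ^ s) = ⊥ := by
  set L := quotCongr p r (s + 1)
  have := finite_quotient_openNormal L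
  have : Nonempty (Fin r × Fin 4) := ⟨(⟨0, hr⟩, 0)⟩
  have hpow : ∀ g : ProdK1 p r ⧸ ProdZ1 p r,
      (QuotientGroup.mk' L.toSubgroup g) ^ p ^ s = 1 := fun g => by
    obtain ⟨g, rfl⟩ := QuotientGroup.mk_surjective g
    rw [← map_pow]
    exact (QuotientGroup.eq_one_iff _).mpr ⟨g ^ p ^ s, pow_mem_prodCongr g s, map_pow _ _ _⟩
  have hP : IsPGroup p ((ProdK1 p r ⧸ ProdZ1 p r) ⧸ L.toSubgroup) := fun g => by
    obtain ⟨g, rfl⟩ := QuotientGroup.mk_surjective g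
    exact ⟨s, hpow g⟩
  -- Modulo the open subgroup `L`, topological generation becomes generation. The case `t = 0` shows
  -- that the generators generate; `t = 1` handles commutators, which have level `p ^ 2`.
  have hcl : ∀ (t : ℕ) (g : ProdK1 p r), g ∈ prodCongr p r (t + 1) →
      QuotientGroup.mk' L.toSubgroup (QuotientGroup.mk' (ProdZ1 p r) g) ∈
        Subgroup.closure (Set.range fun x =>
          QuotientGroup.mk' L.toSubgroup (quotGen p r x) ^ p ^ t) := fun t g hg => by
    obtain ⟨a, ha, b, hb, hab⟩ := Subgroup.mem_sup_of_normal_right.mp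
      (quotCongr_le_closure_sup hp t L ⟨g, hg, rfl⟩)
    have hb1 : QuotientGroup.mk' L.toSubgroup b = 1 := (QuotientGroup.eq_one_iff _).mpr hb
    rw [← hab, map_mul, hb1, mul_one]
    have := Subgroup.mem_map_of_mem (QuotientGroup.mk' L.toSubgroup) ha
    rw [MonoidHom.map_closure, ← Set.range_comp] at this
    exact this
  have key := augIdeal_pow_eq_bot (F := F) p hp hP (s := s)
    (e := fun x : Fin r × Fin 4 => QuotientGroup.mk' L.toSubgroup (quotGen p r x)) ?_ ?_ ?_
  · simpa using key
  · refine eq_top_iff.mpr fun g _ => ?_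
    obtain ⟨g, rfl⟩ := QuotientGroup.mk_surjective g
    obtain ⟨g, rfl⟩ := QuotientGroup.mk_surjective g
    have := hcl 0 g (by rw [zero_add, prodCongr_one]; trivial)
    simp only [pow_zero, pow_one] at this
    exact this
  · intro x y
    have := hcl 1 _ (commutator_mem_prodCongr (prodGen p r x) (prodGen p r y))
    simp only [pow_one] at this
    exact this
  · exact fun x => hpow _

end ProdCongruence

/-! ### Coinvariants -/

section LinearAlgebra

variable {F V : Type*} [Field F] [AddCommGroup V] [Module F V] [Module.Finite F V]

/-- From `fʲ(V)` to `fʲ⁺¹(V)` the dimension drops by that of `ker f ∩ fʲ(V)`, at most `dim ker f =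
dim coker f`. -/
lemma finrank_le_mul_finrank_quotient_range_add (f : V →ₗ[F] V) (k : ℕ) :
    Module.finrank F V ≤ k * Module.finrank F (V ⧸ LinearMap.range f) +
      Module.finrank F (LinearMap.range (f ^ k)) := by
  induction k with
  | zero => rw [zero_mul, zero_add, pow_zero, Module.End.one_eq_id, LinearMap.range_id, finrank_top]
  | succ k ih =>
    have h1 := (f.domRestrict (LinearMap.range (f ^ k))).finrank_range_add_finrank_ker
    have h2 : LinearMap.range (f.domRestrict (LinearMap.range (f ^ k))) =
        LinearMap.range (f ^ (k + 1)) := by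
      rw [LinearMap.range_domRestrict, pow_succ', Module.End.mul_eq_comp, LinearMap.range_comp]
    have h3 : Module.finrank F (LinearMap.ker (f.domRestrict (LinearMap.range (f ^ k)))) ≤
        Module.finrank F (LinearMap.ker f) := by
      rw [← Submodule.finrank_map_subtype_eq]
      refine Submodule.finrank_mono ?_
      rintro _ ⟨x, hx, rfl⟩
      exact hx
    have h4 := f.finrank_range_add_finrank_ker
    have h5 := (LinearMap.range f).finrank_quotient_add_finrank
    rw [h2] at h1
    rw [add_one_mul]
    omega

end LinearAlgebra

section Coinvariants

open Representation

variable {F R K : Type*} [Field F] [Ring R] [Algebra F R] [Monoid K] (σ : K →* R)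
  (M : Type*) [AddCommGroup M] [Module F M] [Module R M] [IsScalarTower F R M]
  {M' : Type*} [AddCommGroup M'] [Module F M'] [Module R M'] [IsScalarTower F R M']

/-- The representation on an `R`-module defined by a homomorphism into the multiplicative monoid
of the `F`-algebra `R`. -/
abbrev repOfHom : Representation F K M :=
  ((Algebra.lsmul F F M : R →ₐ[F] Module.End F M) : R →* Module.End F M).comp σ

variable {M}

/-- The map induced on coinvariants by a homomorphism of `R`-modules. -/
noncomputable def coinvMap (f : M →ₗ[R] M') :
    Coinvariants (repOfHom (F := F) σ M) →ₗ[F] Coinvariants (repOfHom (F := F) σ M') :=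
  Coinvariants.lift _ ((Coinvariants.mk _).comp (f.restrictScalars F)) fun t =>
    LinearMap.ext fun m => by
      have h : f (repOfHom (F := F) σ M t m) = repOfHom (F := F) σ M' t (f m) := map_smul f _ m
      change Coinvariants.mk _ (f (repOfHom (F := F) σ M t m)) = Coinvariants.mk _ (f m)
      rw [h]
      exact Coinvariants.mk_self_apply _ t (f m)

lemma coinvMap_mk (f : M →ₗ[R] M') (m : M) :
    coinvMap (F := F) σ f (Coinvariants.mk _ m) = Coinvariants.mk _ (f m) := rfl

lemma coinvMap_pow_mk (φ : Module.End R M) (k : ℕ) (m : M) :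
    (coinvMap (F := F) σ φ ^ k) (Coinvariants.mk _ m) = Coinvariants.mk _ ((φ ^ k) m) := by
  induction k with
  | zero => rfl
  | succ k ih =>
    rw [pow_succ', pow_succ', Module.End.mul_apply, Module.End.mul_apply, ih, coinvMap_mk]

lemma coinvMap_surjective {f : M →ₗ[R] M'} (hf : Function.Surjective f) :
    Function.Surjective (coinvMap (F := F) σ f) := by
  intro y
  obtain ⟨y, rfl⟩ := Coinvariants.mk_surjective _ y
  obtain ⟨m, rfl⟩ := hf y
  exact ⟨Coinvariants.mk _ m, rfl⟩

/-- Right exactness of coinvariants. -/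
lemma ker_coinvMap_mkQ_le (φ : Module.End R M) :
    LinearMap.ker (coinvMap (F := F) σ (LinearMap.range φ).mkQ) ≤
      LinearMap.range (coinvMap (F := F) σ φ) := by
  intro x hx
  obtain ⟨m, rfl⟩ := Coinvariants.mk_surjective _ x
  rw [LinearMap.mem_ker, coinvMap_mk] at hx
  have hx' := (Coinvariants.mk_eq_zero _).mp hx
  have hle : Coinvariants.ker (repOfHom (F := F) σ (M ⧸ LinearMap.range φ)) ≤
      (Coinvariants.ker (repOfHom (F := F) σ M)).map
        ((LinearMap.range φ).mkQ.restrictScalars F) := by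
    refine Submodule.span_le.mpr ?_
    rintro _ ⟨⟨t, y⟩, rfl⟩
    obtain ⟨y, rfl⟩ := (LinearMap.range φ).mkQ_surjective y
    exact ⟨_, Coinvariants.sub_mem_ker t y, rfl⟩
  obtain ⟨m₁, hm₁, hm⟩ := hle hx'
  have h0 : Coinvariants.mk (repOfHom (F := F) σ M) m₁ = 0 := (Coinvariants.mk_eq_zero _).mpr hm₁
  obtain ⟨z, hz⟩ := (Submodule.Quotient.eq _).mp (show (LinearMap.range φ).mkQ m =
    (LinearMap.range φ).mkQ m₁ from hm.symm)
  refine ⟨Coinvariants.mk _ z, ?_⟩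
  rw [coinvMap_mk, hz, map_sub, h0, sub_zero]

variable (F M) in
/-- The dimension over `F` of the coinvariants of an `R`-module. -/
noncomputable def homCoinvDim : ℕ := Module.finrank F (Coinvariants (repOfHom (F := F) σ M))

variable (F M) in
/-- The coinvariants of an `R`-module are finite dimensional over `F`. -/
def HomCoinvFinite : Prop := Module.Finite F (Coinvariants (repOfHom (F := F) σ M))

variable {σ} (hM : HomCoinvFinite F σ M)

include hM

lemma homCoinvDim_le_of_surjective {f : M →ₗ[R] M'} (hf : Function.Surjective f) :
    homCoinvDim F σ M' ≤
      homCoinvDim F σ M :=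
  have : Module.Finite F (Coinvariants (repOfHom (F := F) σ M)) := hM
  (coinvMap σ f).finrank_le_finrank_of_surjective (coinvMap_surjective σ hf)

lemma finrank_quotient_range_coinvMap_le (φ : Module.End R M) :
    Module.finrank F (Coinvariants (repOfHom (F := F) σ M) ⧸ LinearMap.range (coinvMap (F := F) σ φ)) ≤
      homCoinvDim F σ (M ⧸ LinearMap.range φ) := by
  have : Module.Finite F (Coinvariants (repOfHom (F := F) σ M)) := hM
  have h1 := (LinearMap.range (coinvMap (F := F) σ φ)).finrank_quotient_add_finrank
  have h2 := (coinvMap (F := F) σ (LinearMap.range φ).mkQ).finrank_range_add_finrank_ker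
  have h3 := Submodule.finrank_mono (ker_coinvMap_mkQ_le (F := F) σ φ)
  rw [LinearMap.range_eq_top.mpr (coinvMap_surjective (F := F) σ (LinearMap.range φ).mkQ_surjective),
    finrank_top] at h2
  unfold homCoinvDim
  omega

lemma homCoinvDim_le_mul_add_range (φ : Module.End R M) (k : ℕ) :
    homCoinvDim F σ M ≤
      k * homCoinvDim F σ (M ⧸ LinearMap.range φ) +
        Module.finrank F (LinearMap.range (coinvMap (F := F) σ φ ^ k)) := by
  have : Module.Finite F (Coinvariants (repOfHom (F := F) σ M)) := hM
  refine (finrank_le_mul_finrank_quotient_range_add (coinvMap (F := F) σ φ) k).trans ?_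
  gcongr
  exact finrank_quotient_range_coinvMap_le hM φ

lemma homCoinvDim_le_mul (φ : Module.End R M) (k : ℕ)
    (hk : ∀ m, Coinvariants.mk (repOfHom (F := F) σ M) ((φ ^ k) m) = 0) :
    homCoinvDim F σ M ≤
      k * homCoinvDim F σ (M ⧸ LinearMap.range φ) := by
  have h0 : coinvMap (F := F) σ φ ^ k = 0 := by
    refine LinearMap.ext fun x => ?_
    obtain ⟨m, rfl⟩ := Coinvariants.mk_surjective _ x
    rw [coinvMap_pow_mk, hk, LinearMap.zero_apply]
  have := homCoinvDim_le_mul_add_range hM φ k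
  rwa [h0, LinearMap.range_zero, finrank_bot, add_zero] at this

/-- The map `φᵏ` on coinvariants has image inside that of the coinvariants of `U`. These need not
inject, but only the dimension of the image matters. -/
lemma homCoinvDim_le_mul_add (φ : Module.End R M) (k : ℕ) (U : Submodule R M)
    (hU : ∀ m, (φ ^ k) m ∈ U) (hfin : HomCoinvFinite F σ U) :
    homCoinvDim F σ M ≤ k * homCoinvDim F σ (M ⧸ LinearMap.range φ) + homCoinvDim F σ U := by
  have : Module.Finite F (Coinvariants (repOfHom (F := F) σ M)) := hM
  have : Module.Finite F (Coinvariants (repOfHom (F := F) σ U)) := hfin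
  refine (homCoinvDim_le_mul_add_range hM φ k).trans (add_le_add le_rfl ?_)
  refine le_trans (Submodule.finrank_mono ?_) (coinvMap (F := F) σ U.subtype).finrank_range_le
  rintro _ ⟨x, rfl⟩
  obtain ⟨m, rfl⟩ := Coinvariants.mk_surjective _ x
  exact ⟨Coinvariants.mk _ ⟨(φ ^ k) m, hU m⟩, (coinvMap_pow_mk σ φ k m).symm⟩

end Coinvariants

/-! ### The right ideal that dies in coinvariants. -/

section CoinvariantIdeal

open Representation

variable {F R K : Type*} [Field F] [Ring R] [Algebra F R] [Monoid K] (σ : K →* R)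
  {M : Type*} [AddCommGroup M] [Module F M] [Module R M] [IsScalarTower F R M]

variable (F) in
/-- The right ideal of `R` generated by the `σ t - 1`, as an `F`-subspace. -/
def coinvIdeal : Submodule F R := Submodule.span F {z | ∃ (t : K) (y : R), z = (σ t - 1) * y}

variable {σ}

lemma mk_smul_eq_zero {x : R} (hx : x ∈ coinvIdeal F σ) (m : M) :
    Coinvariants.mk (repOfHom (F := F) σ M) (x • m) = 0 := by
  induction hx using Submodule.span_induction with
  | zero => rw [zero_smul, map_zero]
  | add x y _ _ hx hy => rw [add_smul, map_add, hx, hy, add_zero]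
  | smul c x _ hx => rw [smul_assoc, map_smul, hx, smul_zero]
  | mem x hx =>
    obtain ⟨t, y, rfl⟩ := hx
    rw [mul_smul, sub_smul, one_smul, map_sub, sub_eq_zero]
    exact Coinvariants.mk_self_apply (repOfHom (F := F) σ M) t (y • m)

/-- A surjection from `R ^ d` onto `M` induces one from `(R ⧸ coinvIdeal F σ) ^ d` onto the
coinvariants. -/
lemma homCoinvFinite_of_finite [Finite F] [Module.Finite R M] (h : Finite (R ⧸ coinvIdeal F σ)) :
    HomCoinvFinite F σ M := by
  obtain ⟨d, s, hs⟩ := Module.Finite.exists_fin' R M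
  have hsurj : Function.Surjective fun y : Fin d → R ⧸ coinvIdeal F σ =>
      Coinvariants.mk (repOfHom (F := F) σ M) (s fun i => (y i).out) := by
    intro v
    obtain ⟨m, rfl⟩ := Coinvariants.mk_surjective _ v
    obtain ⟨x, rfl⟩ := hs m
    refine ⟨fun i => Submodule.Quotient.mk (x i), ?_⟩
    beta_reduce
    rw [← sub_eq_zero, ← map_sub, ← map_sub, pi_eq_sum_univ (_ - x), map_sum, map_sum]
    refine Finset.sum_eq_zero fun i _ => ?_
    rw [map_smul]
    refine mk_smul_eq_zero ((Submodule.Quotient.eq _).mp ?_) _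
    exact Quotient.out_eq _
  have : Finite (Coinvariants (repOfHom (F := F) σ M)) := Finite.of_surjective _ hsurj
  exact (Module.Finite.of_finite : Module.Finite F (Coinvariants (repOfHom (F := F) σ M)))

end CoinvariantIdeal

/-! ### Iterates of an endomorphism and its restriction to `φᵏ(M)`. -/

section Endomorphisms

variable {R M : Type*} [Ring R] [AddCommGroup M] [Module R M]

/-- Linearity: each block `φᵏ` produces a factor from `J`, which the remaining iterates leave on the
left. -/
lemma pow_mul_apply_mem_pow_smul {F : Type*} [Field F] [Algebra F R] [Module F M]
    [IsScalarTower F R M] {J : Submodule F R} {φ : Module.End R M} {k : ℕ}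
    (hk : ∀ m : M, (φ ^ k) m ∈ J • (⊤ : Submodule F M)) (a : ℕ) (m : M) :
    (φ ^ (k * a)) m ∈ J ^ a • (⊤ : Submodule F M) := by
  induction a generalizing m with
  | zero => rw [pow_zero, Submodule.one_smul]; trivial
  | succ a ih =>
    rw [mul_add_one, pow_add φ, Module.End.mul_apply]
    refine Submodule.smul_induction_on (hk m) (fun j hj m' _ => ?_) fun x y hx hy => ?_
    · rw [map_smul, pow_succ', ← smul_eq_mul, Submodule.smul_assoc]
      exact Submodule.smul_mem_smul hj (ih m')
    · rw [map_add]; exact Submodule.add_mem _ hx hy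

/-- The restriction of `φ` to `φᵏ(M)`. -/
def restrictRangePow (φ : Module.End R M) (k : ℕ) : Module.End R (LinearMap.range (φ ^ k)) :=
  φ.restrict (p := LinearMap.range (φ ^ k)) (q := LinearMap.range (φ ^ k)) <| by
    rintro _ ⟨y, rfl⟩
    exact ⟨φ y, by rw [← Module.End.mul_apply, ← pow_succ, pow_succ', Module.End.mul_apply]⟩

lemma coe_restrictRangePow_pow (φ : Module.End R M) (k j : ℕ) (x : LinearMap.range (φ ^ k)) :
    ((restrictRangePow φ k ^ j) x : M) = (φ ^ j) x := by
  induction j with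
  | zero => rfl
  | succ j ih =>
    rw [pow_succ', pow_succ', Module.End.mul_apply, Module.End.mul_apply, ← ih]; rfl

lemma iInf_range_restrictRangePow_pow {φ : Module.End R M}
    (hφ : (⨅ k ≥ 1, LinearMap.range (φ ^ k)) = ⊥) (k : ℕ) :
    (⨅ j ≥ 1, LinearMap.range (restrictRangePow φ k ^ j)) = ⊥ := by
  refine (Submodule.eq_bot_iff _).mpr fun x hx => Subtype.ext ?_
  have : (x : M) ∈ (⨅ j ≥ 1, LinearMap.range (φ ^ j)) := by
    simp only [Submodule.mem_iInf] at hx ⊢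
    intro j hj
    obtain ⟨y, rfl⟩ := hx j hj
    exact ⟨y, (coe_restrictRangePow_pow φ k j y).symm⟩
  rw [hφ] at this
  exact this

/-- Identifies the cokernel of the restricted endomorphism with the graded piece. -/
lemma range_restrictRangePow (φ : Module.End R M) (k : ℕ) :
    LinearMap.range (restrictRangePow φ k) =
      (LinearMap.range (φ ^ (k + 1))).submoduleOf (LinearMap.range (φ ^ k)) := by
  ext x
  rw [Submodule.submoduleOf, Submodule.mem_comap, pow_succ']
  constructor
  · rintro ⟨⟨_, y, rfl⟩, rfl⟩
    exact ⟨y, rfl⟩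
  · rintro ⟨y, hy⟩
    exact ⟨⟨(φ ^ k) y, y, rfl⟩, Subtype.ext hy⟩

end Endomorphisms

/-! ### Growth estimates for an abstract family of coinvariants. -/

section Growth

open Representation

variable {F R : Type*} [Field F] [Finite F] [Ring R] [Algebra F R] {ν : Type*} {K : ν → Type*}
  [∀ n, Monoid (K n)] {σ : ∀ n, K n →* R} {J : Submodule F R} {q : ν → ℕ} {C : ℕ}
  {M : Type*} [AddCommGroup M] [Module F M] [Module R M] [IsScalarTower F R M] [Module.Finite R M]
  (hfin : ∀ n, Finite (R ⧸ coinvIdeal F (σ n)))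

include hfin

theorem comparable_homCoinvDim {φ : Module.End R M} (hφ : IsNilpotent φ) :
    Comparable (fun n => homCoinvDim F (σ n) M)
      (fun n => homCoinvDim F (σ n) (M ⧸ LinearMap.range φ)) := by
  obtain ⟨k, hk⟩ := hφ
  refine ⟨⟨k, fun n => ?_⟩, ⟨1, fun n => ?_⟩⟩
  · exact homCoinvDim_le_mul (homCoinvFinite_of_finite (hfin n)) φ k
      fun m => by rw [hk, LinearMap.zero_apply, map_zero]
  · rw [one_mul]
    exact homCoinvDim_le_of_surjective (homCoinvFinite_of_finite (hfin n))
      (LinearMap.range φ).mkQ_surjective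

variable (hJ : ∀ n, J ^ (C * q n) ≤ coinvIdeal F (σ n))

include hJ

/-- If a power of `φ` maps `M` into `J M`, the coinvariants of `M` grow at most like `q` times
those of `M / φ(M)`. -/
theorem dominated_homCoinvDim {φ : Module.End R M} {k : ℕ}
    (hk : ∀ m : M, (φ ^ k) m ∈ J • (⊤ : Submodule F M)) :
    Dominated (fun n => homCoinvDim F (σ n) M)
      (fun n => q n * homCoinvDim F (σ n) (M ⧸ LinearMap.range φ)) := by
  refine ⟨k * C, fun n => ?_⟩
  have h := homCoinvDim_le_mul (homCoinvFinite_of_finite (M := M) (hfin n)) φ (k * (C * q n))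
    fun m => Submodule.smul_induction_on (pow_mul_apply_mem_pow_smul hk _ m)
      (fun j hj m' _ => mk_smul_eq_zero (hJ n hj) m')
      fun x y hx hy => by rw [map_add, hx, hy, add_zero]
  simpa only [mul_assoc] using h

/-- The first `k` steps cost `k` copies of the coinvariants of `M/φ(M)`; the rest is bounded by the
coinvariants of `φᵏ(M)`, itself finitely generated as an image of `M`. -/
theorem dominated_homCoinvDim_max {φ : Module.End R M} {k k' : ℕ}
    (hk' : ∀ m, (restrictRangePow φ k ^ k') m ∈
      J • (⊤ : Submodule F (LinearMap.range (φ ^ k)))) :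
    Dominated (fun n => homCoinvDim F (σ n) M)
      (fun n => max (homCoinvDim F (σ n) (M ⧸ LinearMap.range φ))
        (q n * homCoinvDim F (σ n) (gradedPiece φ k))) := by
  obtain ⟨C', hC'⟩ := dominated_homCoinvDim hfin hJ hk'
  rw [range_restrictRangePow] at hC'
  refine ⟨k + C', fun n => ?_⟩
  rw [add_mul]
  refine (homCoinvDim_le_mul_add (homCoinvFinite_of_finite (hfin n)) φ k
    (LinearMap.range (φ ^ k)) (fun m => ⟨m, rfl⟩)
    (homCoinvFinite_of_finite (hfin n))).trans
    (add_le_add (Nat.mul_le_mul_left _ (le_max_left _ _)) ?_)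
  exact (hC' n).trans (Nat.mul_le_mul_left _ (le_max_right _ _))

end Growth

/-! ### Growth over completed group algebras. -/

section CompletedGroupAlgebra

namespace completedGroupAlgebra

variable {F G H ι : Type*} [Field F] [Finite F] [Group G] [TopologicalSpace G] [Group H]
  [Fintype ι] {f : H →* G} {T : Subgroup H} {L : OpenNormalSubgroup G} {h : ι → H}
  (hG : ∀ N : OpenNormalSubgroup G, Finite (G ⧸ N.toSubgroup)) (hT : ∀ i, h i ∈ T)
  (hL : ∀ N : OpenNormalSubgroup G, L.toSubgroup ≤
    Subgroup.closure (Set.range fun i => f (h i)) ⊔ N.toSubgroup)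

include hG hT hL

/-- If `L` is topologically generated by the images of elements of `T`, the kernel of
`F[[G]] → F[G/L]` lies in the right ideal generated by the `t - 1` with `t ∈ T`. -/
lemma mem_coinvIdeal_of_proj_eq_zero {x : completedGroupAlgebra F G} (hx : proj F L x = 0) :
    x ∈ coinvIdeal F (((of F G).comp f).comp T.subtype) := by
  obtain ⟨y, rfl⟩ := exists_eq_sum_of_proj_eq_zero hG L (fun i => f (h i)) hL x hx
  exact Submodule.sum_mem _ fun i _ => Submodule.subset_span ⟨⟨h i, hT i⟩, y i, rfl⟩

lemma finite_quotient_coinvIdeal :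
    Finite (completedGroupAlgebra F G ⧸ coinvIdeal F (((of F G).comp f).comp T.subtype)) := by
  have := hG L
  have := MonoidAlgebra.finite_of_finite F (G ⧸ L.toSubgroup)
  have : Finite (completedGroupAlgebra F G ⧸ LinearMap.ker (proj F L).toLinearMap) :=
    Finite.of_injective _ (proj F L).toLinearMap.quotKerEquivRange.injective
  have hle : LinearMap.ker (proj F L).toLinearMap ≤
      coinvIdeal F (((of F G).comp f).comp T.subtype) :=
    fun x hx => mem_coinvIdeal_of_proj_eq_zero hG hT hL hx
  exact Finite.of_surjective _ (Submodule.factor_surjective hle)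

/-- Nilpotency at the finite level `L` sends `Jᵃ` to zero in `F[G/L]`, and the kernel of that
projection dies in coinvariants. -/
lemma aug_pow_le_coinvIdeal {a : ℕ} (ha : augIdeal F (G ⧸ L.toSubgroup) ^ a = ⊥) :
    aug F G ^ a ≤ coinvIdeal F (((of F G).comp f).comp T.subtype) := fun x hx => by
  have h1 := proj_mem_augIdeal_pow L hx
  rw [ha, Submodule.mem_bot] at h1
  exact mem_coinvIdeal_of_proj_eq_zero hG hT hL h1

end completedGroupAlgebra

/-- Growth of the coinvariants of a finitely generated `F[[G]]`-module under a family of subgroups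
`T n` of a group `H` mapping to `G`. The images of the `T n` contain topological generators of open
normal subgroups `L n` of `G`, and the augmentation ideal of `F[G/L n]` is nilpotent of order
at most `C q(n)`. -/
theorem completedGroupAlgebra.growth {F G H ι ν : Type*} [Field F] [Finite F] [Group G]
    [TopologicalSpace G] [Group H] [Fintype ι] (f : H →* G) (T : ν → Subgroup H) (q : ν → ℕ)
    (C : ℕ) (L : ν → OpenNormalSubgroup G) (h : ν → ι → H)
    (hG : ∀ N : OpenNormalSubgroup G, Finite (G ⧸ N.toSubgroup)) (hT : ∀ n i, h n i ∈ T n)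
    (hL : ∀ (n : ν) (N : OpenNormalSubgroup G), (L n).toSubgroup ≤
      Subgroup.closure (Set.range fun i => f (h n i)) ⊔ N.toSubgroup)
    (hnil : ∀ n, augIdeal F (G ⧸ (L n).toSubgroup) ^ (C * q n) = ⊥)
    {M : Type*} [AddCommGroup M] [Module F M] [Module (completedGroupAlgebra F G) M]
    [IsScalarTower F (completedGroupAlgebra F G) M] [Module.Finite (completedGroupAlgebra F G) M]
    (φ : Module.End (completedGroupAlgebra F G) M)
    (hφ : (⨅ k ≥ 1, LinearMap.range (φ ^ k)) = ⊥) :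
    (∀ n, HomCoinvFinite F (((completedGroupAlgebra.of F G).comp f).comp (T n).subtype) M) ∧
    (IsNilpotent φ → Comparable
      (fun n => homCoinvDim F (((completedGroupAlgebra.of F G).comp f).comp (T n).subtype) M)
      (fun n => homCoinvDim F (((completedGroupAlgebra.of F G).comp f).comp (T n).subtype)
        (M ⧸ LinearMap.range φ))) ∧
    (∀ k, Dominated
      (fun n => homCoinvDim F (((completedGroupAlgebra.of F G).comp f).comp (T n).subtype) M)
      (fun n => max (homCoinvDim F (((completedGroupAlgebra.of F G).comp f).comp (T n).subtype)
        (M ⧸ LinearMap.range φ))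
        (q n * homCoinvDim F (((completedGroupAlgebra.of F G).comp f).comp (T n).subtype)
          (gradedPiece φ k)))) ∧
    Dominated
      (fun n => homCoinvDim F (((completedGroupAlgebra.of F G).comp f).comp (T n).subtype) M)
      (fun n => q n * homCoinvDim F (((completedGroupAlgebra.of F G).comp f).comp (T n).subtype)
        (M ⧸ LinearMap.range φ)) := by
  have hfin := fun n => finite_quotient_coinvIdeal (F := F) hG (hT n) (hL n)
  have hJ := fun n => aug_pow_le_coinvIdeal hG (hT n) (hL n) (hnil n)
  refine ⟨fun n => homCoinvFinite_of_finite (hfin n), fun h => comparable_homCoinvDim hfin h,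
    fun k => ?_, ?_⟩
  · obtain ⟨k', hk'⟩ := completedGroupAlgebra.exists_pow_apply_mem_aug_smul hG
      (M := LinearMap.range (φ ^ k)) (restrictRangePow φ k) (iInf_range_restrictRangePow_pow hφ k)
    exact dominated_homCoinvDim_max hfin hJ hk'
  · obtain ⟨k, hk⟩ := completedGroupAlgebra.exists_pow_apply_mem_aug_smul hG φ hφ
    exact dominated_homCoinvDim hfin hJ hk

end CompletedGroupAlgebra

/-! ### The inputs for `𝒦₁/𝒵₁` at level `p ^ κ(n)`. -/

section IwasawaAlgebra

variable {F : Type*} [Field F] [Finite F] {p : ℕ} [Fact p.Prime] {r : ℕ}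

lemma one_le_kappa (hr : 1 ≤ r) (n : Fin r → ℕ+) : 1 ≤ kappa n :=
  (n ⟨0, hr⟩).pos.trans_le
    (Finset.le_sup (f := fun i => (n i : ℕ)) (Finset.mem_univ (⟨0, hr⟩ : Fin r)))

lemma augIdeal_quotCongr_kappa_pow_eq_bot [CharP F p] (hp : 3 ≤ p) (hr : 1 ≤ r)
    (n : Fin r → ℕ+) :
    augIdeal F ((ProdK1 p r ⧸ ProdZ1 p r) ⧸ (quotCongr p r (kappa n)).toSubgroup) ^
      (r * 4 * p ^ kappa n) = ⊥ := by
  obtain ⟨s, hs⟩ := Nat.exists_eq_add_of_le' (one_le_kappa hr n)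
  -- Level `p ^ (s + 1)` already gives vanishing in degree `4 r p ^ s`; the exponent is padded to `4
  -- r p ^ κ`.
  have hle : r * 4 * p ^ s ≤ r * 4 * p ^ kappa n :=
    Nat.mul_le_mul_left _ (Nat.pow_le_pow_right (by omega) (by omega))
  obtain ⟨m, hm⟩ := Nat.exists_eq_add_of_le hle
  rw [hm, hs, pow_add, augIdeal_quotCongr_pow_eq_bot F hp hr s, Submodule.bot_mul]

lemma quotCongr_kappa_le_closure_sup (hp : 3 ≤ p) (hr : 1 ≤ r) (n : Fin r → ℕ+)
    (L : OpenNormalSubgroup (ProdK1 p r ⧸ ProdZ1 p r)) :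
    (quotCongr p r (kappa n)).toSubgroup ≤ Subgroup.closure (Set.range fun x =>
      QuotientGroup.mk' (ProdZ1 p r) (prodGen p r x ^ p ^ (kappa n - 1))) ⊔ L.toSubgroup := by
  have h := quotCongr_le_closure_sup hp (kappa n - 1) L
  rw [Nat.sub_add_cancel (one_le_kappa hr n)] at h
  exact h

lemma prodGen_pow_mem_ProdT1 (hr : 1 ≤ r) (n : Fin r → ℕ+) (x : Fin r × Fin 4) :
    prodGen p r x ^ p ^ (kappa n - 1) ∈ ProdT1 p n := by
  have h := pow_mem_prodCongr (prodGen p r x) (kappa n - 1)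
  rw [Nat.sub_add_cancel (one_le_kappa hr n)] at h
  exact prodCongr_le_ProdT1 n h

end IwasawaAlgebra

theorem mainTheorem8 (p : ℕ) [Fact p.Prime] (hp : 5 ≤ p) (r : ℕ) (hr : 1 ≤ r)
    (F : Type*) [Field F] [Finite F] [CharP F p]
    (M : Type*) [AddCommGroup M] [Module F M] [Module (Lam F p r) M]
    [IsScalarTower F (Lam F p r) M] [Module.Finite (Lam F p r) M]
    (φ : Module.End (Lam F p r) M)
    (hφ : (⨅ k ≥ 1, LinearMap.range (φ ^ k)) = ⊥) :
    (∀ n : Fin r → ℕ+, Module.Finite F (coinv F p M n)) ∧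
    (IsNilpotent φ →
      Comparable (fun n : Fin r → ℕ+ => dimCoinv F p M n)
        (fun n => dimCoinv F p (M ⧸ LinearMap.range φ) n)) ∧
    (¬ IsNilpotent φ →
      ∃ k₁ : ℕ, ∀ k₀ ≥ k₁,
        Dominated (fun n : Fin r → ℕ+ => dimCoinv F p M n)
          (fun n => max (dimCoinv F p (M ⧸ LinearMap.range φ) n)
            (p ^ kappa n * dimCoinv F p (gradedPiece φ k₀) n))) ∧
    Dominated (fun n : Fin r → ℕ+ => dimCoinv F p M n)
      (fun n => p ^ kappa n * dimCoinv F p (M ⧸ LinearMap.range φ) n) := by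
  have hp3 : 3 ≤ p := by omega
  have key := @completedGroupAlgebra.growth F (ProdK1 p r ⧸ ProdZ1 p r) (ProdK1 p r)
    (Fin r × Fin 4) (Fin r → ℕ+) _ _ _ _ _ _ (QuotientGroup.mk' (ProdZ1 p r))
    (fun n => ProdT1 p n) (fun n => p ^ kappa n) (r * 4) (fun n => quotCongr p r (kappa n))
    (fun n x => prodGen p r x ^ p ^ (kappa n - 1)) finite_quotient_openNormal
    (prodGen_pow_mem_ProdT1 hr) (quotCongr_kappa_le_closure_sup hp3 hr)
    (augIdeal_quotCongr_kappa_pow_eq_bot hp3 hr) M _ _ _ _ _ φ hφ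
  -- The threshold is `0`: the estimate in (ii) holds for every `k₀`.
  exact ⟨key.1, key.2.1, fun _ => ⟨0, fun k _ => key.2.2.1 k⟩, key.2.2.2⟩
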